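/- Let $d\ge 1$, $\alpha\le d$, and fix constants $C_\alpha$, $\sigma\ge 0$, $L\ge 0$, $c>0$, $\kappa>0$, $r_0>0$, $M$. Then there is a constant $C>0$, depending only on $d,\alpha,C_\alpha,\sigma,L,c,\kappa,r_0,M$, such that the following holds. Let $\mathcal A$ be a finite set of actions, let $\mathcal X\subseteq\mathbb R^d$ be a measurable context space with a probability density $f$ on it (with respect to Lebesgue measure, contexts $\mathbf X\sim f$), let $\eta_a:\mathcal X\to\mathbb R$, $a\in\mathcal A$, be the expected reward functions, and put $\eta^*=\max_a\eta_a$. Let $\|\cdot\|$ be the Euclidean norm. Assume * (margin) $\mathrm P(0<\eta^*(\mathbf X)-\eta_a(\mathbf X)<u)\le C_\alpha u^\alpha$ for all $a\in\mathcal A$, $u>0$; * (Lipschitz) $|\eta_a(\mathbf x)-\eta_a(\mathbf x')|\le L\|\mathbf x-\mathbf x'\|$ for all $a\in\mathcal A$ and $\mathbf x,\mathbf x'\in\mathcal X$; * (density bounded below) $f(\mathbf x)\ge c$ for all $\mathbf x\in\mathcal X$; * (regular support) $\mathrm{vol}(\mathcal X\cap B(\mathbf x,r))\ge\kappa\,\mathrm{vol}(B(\mathbf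 x,r))$ for all $\mathbf x\in\mathcal X$ and $0<r\le r_0$ (together with the previous condition this makes $\mathcal X$ bounded); * $M$ is a bound for the suboptimality gaps: $\eta^*(\mathbf x)-\eta_a(\mathbf x)\le M$ for all $\mathbf x\in\mathcal X$, $a\in\mathcal A$ (some such $M$ exists for every instance with the properties above). Let $T\ge 2$. At each step $t=1,\dots,T$ a context $\mathbf X_t$ is drawn from $f$ independently of the past, an action $A_t$ is chosen, and a reward $Y_t=\eta_{A_t}(\mathbf X_t)+W_t$ is received, where the noise is conditionally subgaussian: $\mathbb E[e^{\lambda W_t}\mid (\mathbf X_i,A_i,Y_i)_{i<t},\mathbf X_t,A_t]\le e^{\lambda^2\sigma^2/2}$ for all $\lambda\in\mathbb R$. The actions follow the adaptive-$k$ kNN-UCB method: $A_t\in\arg\max_a\hat\eta_{a,t}(\mathbf X_t)$ with ties broken in any way, where, with $\rho_{a,t,j}(\mathbf x)$ the distance from $\mathbf x$ to its $j$-th nearest neighbor among $\{\mathbf X_i: i<t, A_i=a\}$, one sets $\hat\eta_{a,t}(\mathbf x)=\infty$ if there is no $i<t$ with $A_i=a$ or if $L\rho_{a,t,1}(\mathbf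 x)>\sqrt{\ln T}$, and otherwise $$k=\max\Big\{j\ge1: L\rho_{a,t,j}(\mathbf x)\le\sqrt{\tfrac{\ln T}{j}}\Big\},\qquad \hat\eta_{a,t}(\mathbf x)=\frac1k\sum_{i\in\mathcal N}Y_i+\sqrt{\frac{2\sigma^2}{k}\ln\big(dT^{2d+3}|\mathcal A|\big)}+L\rho_{a,t,k}(\mathbf x),$$ where $j$ runs over the indices up to the number of steps $i<t$ with $A_i=a$, and $\mathcal N$ is the set of the $k$ nearest neighbors of $\mathbf x$ among those steps. Then the cumulative regret is integrable and $$\mathbb E\Big[\sum_{t=1}^T\big(\eta^*(\mathbf X_t)-\eta_{A_t}(\mathbf X_t)\big)\Big]\le C\,T|\mathcal A|\Big(\frac{T}{\ln T}\Big)^{-\frac{1+\alpha}{d+2}}.$$ -/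

import Mathlib

open MeasureTheory ProbabilityTheory
open scoped NNReal ENNReal

universe u v

noncomputable section

/-! ## Reward functions, suboptimality gap and context distribution -/

/-- `η*(x) = max_a η_a(x)`. The set of actions is finite (and nonempty in use), so the supremum is
a maximum. -/
def bestReward {𝒜 : Type u} {d : ℕ} (η : 𝒜 → EuclideanSpace ℝ (Fin d) → ℝ)
    (x : EuclideanSpace ℝ (Fin d)) : ℝ :=
  ⨆ a, η a x

/-- The suboptimality gap `η*(x) - η_a(x)`. -/
def gap {𝒜 : Type u} {d : ℕ} (η : 𝒜 → EuclideanSpace ℝ (Fin d) → ℝ) (a : 𝒜)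
    (x : EuclideanSpace ℝ (Fin d)) : ℝ :=
  bestReward η x - η a x

/-- The distribution on the context space `𝒳 ⊆ ℝᵈ` with density `f` with respect to Lebesgue
measure. -/
def contextLaw {d : ℕ} (𝒳 : Set (EuclideanSpace ℝ (Fin d)))
    (f : EuclideanSpace ℝ (Fin d) → ℝ) : Measure (EuclideanSpace ℝ (Fin d)) :=
  (volume.restrict 𝒳).withDensity fun x => ENNReal.ofReal (f x)

/-- `f` is a probability density on the (measurable) context space `𝒳`. -/
structure IsContextDensity {d : ℕ} (𝒳 : Set (EuclideanSpace ℝ (Fin d)))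
    (f : EuclideanSpace ℝ (Fin d) → ℝ) : Prop where
  measurableSet : MeasurableSet 𝒳
  measurable : Measurable f
  nonneg : ∀ x ∈ 𝒳, 0 ≤ f x
  lintegral_eq_one : ∫⁻ x in 𝒳, ENNReal.ofReal (f x) = 1

/-- Tsybakov margin condition: `P(0 < η*(X) - η_a(X) < u) ≤ C_α u^α` for all `a` and `u > 0`. -/
def TsybakovMargin {𝒜 : Type u} {d : ℕ} (α Cα : ℝ) (𝒳 : Set (EuclideanSpace ℝ (Fin d)))
    (f : EuclideanSpace ℝ (Fin d) → ℝ) (η : 𝒜 → EuclideanSpace ℝ (Fin d) → ℝ) : Prop :=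
  ∀ a : 𝒜, ∀ w : ℝ, 0 < w →
    contextLaw 𝒳 f {x | 0 < gap η a x ∧ gap η a x < w} ≤ ENNReal.ofReal (Cα * w ^ α)

/-- Every small ball centred in `𝒳` has a fixed proportion of its volume in `𝒳`. -/
def IsVolumeRegular {d : ℕ} (κ r₀ : ℝ) (𝒳 : Set (EuclideanSpace ℝ (Fin d))) : Prop :=
  ∀ x ∈ 𝒳, ∀ r : ℝ, 0 < r → r ≤ r₀ →
    ENNReal.ofReal κ * volume (Metric.ball x r) ≤ volume (𝒳 ∩ Metric.ball x r)

/-! ## The adaptive nearest neighbor UCB rule, on one trajectory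

Time steps are numbered `0, …, T - 1`. A trajectory consists of contexts `X i`, actions `A i` and
rewards `Y i`. -/

open Classical in
/-- The previous steps with action `a`, i.e. `{i < t | A_i = a}`. -/
def samples {𝒜 : Type u} (A : ℕ → 𝒜) (t : ℕ) (a : 𝒜) : Finset ℕ :=
  (Finset.range t).filter fun i => A i = a

open Classical in
/-- The number of samples in `S` that are nearer to `x` than sample `i` is (equal distances, which
have probability zero when contexts have a density, are ordered by time). -/
def neighborRank {d : ℕ} (X : ℕ → EuclideanSpace ℝ (Fin d)) (S : Finset ℕ)
    (x : EuclideanSpace ℝ (Fin d)) (i : ℕ) : ℕ :=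
  (S.filter fun l => dist (X l) x < dist (X i) x ∨ (dist (X l) x = dist (X i) x ∧ l < i)).card

/-- The `j` nearest neighbors of `x` among the samples in `S` (for `j ≤ |S|`). -/
def nearest {d : ℕ} (X : ℕ → EuclideanSpace ℝ (Fin d)) (S : Finset ℕ)
    (x : EuclideanSpace ℝ (Fin d)) (j : ℕ) : Finset ℕ :=
  S.filter fun i => neighborRank X S x i < j

/-- The distance `ρ_j(x)` from `x` to its `j`-th nearest neighbor among the samples in `S`
(for `1 ≤ j ≤ |S|`). -/
def knnDist {d : ℕ} (X : ℕ → EuclideanSpace ℝ (Fin d)) (S : Finset ℕ)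
    (x : EuclideanSpace ℝ (Fin d)) (j : ℕ) : ℝ≥0 :=
  (nearest X S x j).sup fun i => nndist (X i) x

open Classical in
/-- `k(x) = max {j | L ρ_j(x) ≤ √(ln T / j)}`, where `j` runs over `1, …, |S|`. -/
def adaptiveK {d : ℕ} (L : ℝ≥0) (T : ℕ) (X : ℕ → EuclideanSpace ℝ (Fin d)) (S : Finset ℕ)
    (x : EuclideanSpace ℝ (Fin d)) : ℕ :=
  ((Finset.Icc 1 S.card).filter fun j =>
    (L : ℝ) * knnDist X S x j ≤ √(Real.log T / j)).sup id

/-- The exploration term `b = √(2 σ² ln(d T^(2d+3) |𝒜|) / k)`. -/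
def explorationBonus (d : ℕ) (σ : ℝ≥0) (T cardA k : ℕ) : ℝ :=
  √(2 * (σ : ℝ) ^ 2 / k * Real.log (d * (T : ℝ) ^ (2 * d + 3) * cardA))

open Classical in
/-- The upper confidence bound of action `a` at context `x` before step `t`: it is infinite when
there is no sample with action `a` at distance at most `√(ln T) / L` from `x`. -/
def ucb {𝒜 : Type u} [Fintype 𝒜] {d : ℕ} (σ L : ℝ≥0) (T : ℕ)
    (X : ℕ → EuclideanSpace ℝ (Fin d)) (A : ℕ → 𝒜) (Y : ℕ → ℝ) (t : ℕ) (a : 𝒜)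
    (x : EuclideanSpace ℝ (Fin d)) : EReal :=
  let S := samples A t a
  let k := adaptiveK L T X S x
  if S = ∅ ∨ √(Real.log T) < (L : ℝ) * knnDist X S x 1 then ⊤
  else (((∑ i ∈ nearest X S x k, Y i) / k + explorationBonus d σ T (Fintype.card 𝒜) k
    + (L : ℝ) * knnDist X S x k : ℝ) : EReal)

/-- The actions are chosen by the adaptive nearest neighbor UCB method with horizon `T`: each one
maximizes the upper confidence bound at the current context; ties may be broken in any way. -/
def FollowsAdaptiveUCB {𝒜 : Type u} [Fintype 𝒜] {d : ℕ} (σ L : ℝ≥0) (T : ℕ)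
    (X : ℕ → EuclideanSpace ℝ (Fin d)) (A : ℕ → 𝒜) (Y : ℕ → ℝ) : Prop :=
  ∀ t < T, ∀ a : 𝒜, ucb σ L T X A Y t a (X t) ≤ ucb σ L T X A Y t (A t) (X t)

/-! ## The stochastic bandit process -/

/-- The σ-algebra generated by `(X_i, A_i, Y_i)`, `i < t`. -/
abbrev pastSigma {Ω : Type v} {𝒜 : Type u} {d : ℕ} (X : ℕ → Ω → EuclideanSpace ℝ (Fin d))
    (A : ℕ → Ω → 𝒜) (Y : ℕ → Ω → ℝ) (t : ℕ) : MeasurableSpace Ω :=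
  ⨆ (i : ℕ) (_ : i < t),
    MeasurableSpace.comap (X i) inferInstance ⊔ MeasurableSpace.comap (A i) ⊤ ⊔
      MeasurableSpace.comap (Y i) inferInstance

/-- The σ-algebra of what precedes the reward of step `t`: the past, `X_t` and `A_t`. -/
abbrev decisionSigma {Ω : Type v} {𝒜 : Type u} {d : ℕ} (X : ℕ → Ω → EuclideanSpace ℝ (Fin d))
    (A : ℕ → Ω → 𝒜) (Y : ℕ → Ω → ℝ) (t : ℕ) : MeasurableSpace Ω :=
  pastSigma X A Y t ⊔ MeasurableSpace.comap (X t) inferInstance ⊔ MeasurableSpace.comap (A t) ⊤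

/-- The noise `W_t = Y_t - η_{A_t}(X_t)`. -/
def noise {Ω : Type v} {𝒜 : Type u} {d : ℕ} (η : 𝒜 → EuclideanSpace ℝ (Fin d) → ℝ)
    (X : ℕ → Ω → EuclideanSpace ℝ (Fin d)) (A : ℕ → Ω → 𝒜) (Y : ℕ → Ω → ℝ) (t : ℕ) (ω : Ω) : ℝ :=
  Y t ω - η (A t ω) (X t ω)

/-- A contextual bandit process over `T` steps: each context is drawn from the density `f`
independently of the past, and the noise is conditionally subgaussian with parameter `σ²` (hence
conditionally centred) given everything that precedes the reward. -/
structure IsBanditProcess {Ω : Type v} [MeasurableSpace Ω] (μ : Measure Ω) {𝒜 : Type u} {d : ℕ}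
    (σ : ℝ≥0) (T : ℕ) (𝒳 : Set (EuclideanSpace ℝ (Fin d)))
    (f : EuclideanSpace ℝ (Fin d) → ℝ) (η : 𝒜 → EuclideanSpace ℝ (Fin d) → ℝ)
    (X : ℕ → Ω → EuclideanSpace ℝ (Fin d)) (A : ℕ → Ω → 𝒜) (Y : ℕ → Ω → ℝ) : Prop where
  measurable_context : ∀ t < T, Measurable (X t)
  measurable_action : ∀ t < T, ∀ a : 𝒜, MeasurableSet {ω | A t ω = a}
  measurable_reward : ∀ t < T, Measurable (Y t)
  context_law : ∀ t < T, μ.map (X t) = contextLaw 𝒳 f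
  context_indep : ∀ t < T,
    Indep (pastSigma X A Y t) (MeasurableSpace.comap (X t) inferInstance) μ
  noise_integrable : ∀ t < T, ∀ s : ℝ,
    Integrable (fun ω => Real.exp (s * noise η X A Y t ω)) μ
  noise_subgaussian : ∀ t < T, ∀ s : ℝ,
    μ[fun ω => Real.exp (s * noise η X A Y t ω) | decisionSigma X A Y t] ≤ᵐ[μ]
      fun _ => Real.exp (s ^ 2 * (σ : ℝ) ^ 2 / 2)

/-- The cumulative regret `∑_t (η*(X_t) - η_{A_t}(X_t))` over `T` steps. -/
def cumulativeRegret {Ω : Type v} {𝒜 : Type u} {d : ℕ}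
    (η : 𝒜 → EuclideanSpace ℝ (Fin d) → ℝ) (T : ℕ)
    (X : ℕ → Ω → EuclideanSpace ℝ (Fin d)) (A : ℕ → Ω → 𝒜) (ω : Ω) : ℝ :=
  ∑ t ∈ Finset.range T, gap η (A t ω) (X t ω)

end

/-! Suppose that all noise sums over nearest neighbors stay within what the exploration bonus
allows. Then every index is an upper bound for the true reward (`le_ucb`), so the gap of the chosen
action is at most twice the width of its bound, which is of order √(ln T / k) by the definition of
k. If the gap is at least Δ, fewer than j ≈ ln T / Δ² earlier samples of that action lie within ρΔ
of the context: otherwise k ≥ j and the width would be too small (`card_near_lt`).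

Hence, for a fixed action and gaps in [Δ, 2Δ), the balls of radius ρΔ/2 around the contexts overlap
at most j times. Each has mass at least of order Δ^d, and all lie in {0 < gap < 4Δ}, which has mass
at most of order Δ^α. So there are at most about ln T · Δ^(α-d-2) such steps (`card_levelSteps_le`),
with regret ln T · Δ^(α-d-1). As α ≤ d, the sum over dyadic levels is geometric
(`sum_large_gap_le`). Gaps below Δ cost at most T |𝒜| Cα Δ^(1+α) in expectation, and Δ^(d+2) = ln T
/ T balances the two.

For the noise, the difficulty is that the neighbors of X_t are selected with knowledge of contexts
later than the samples. Since later contexts are independent of the past, the noise stays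
subgaussian given all contexts (`IsBanditProcess.exists_conditional_bound`). Given the contexts,
whether step i is among the samples not farther from X_t than X_j depends only on A_i, which
precedes the noise. An exponential supermartingale, Chernoff's bound and a union bound over t, a, j,
the number of neighbors and the sign then give failure probability at most 2 / T, at a cost of at
most 2M. -/

/-! ## Nearest neighbors on one trajectory -/

section Neighbors

variable {d : ℕ} {X : ℕ → EuclideanSpace ℝ (Fin d)} {S : Finset ℕ} {x : EuclideanSpace ℝ (Fin d)}

/-- Sample `l` precedes sample `i` in the order by distance to `x` and then by time. -/
def Nearer (X : ℕ → EuclideanSpace ℝ (Fin d)) (x : EuclideanSpace ℝ (Fin d)) (l i : ℕ) : Prop :=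
  dist (X l) x < dist (X i) x ∨ (dist (X l) x = dist (X i) x ∧ l < i)

theorem Nearer.irrefl (i : ℕ) : ¬ Nearer X x i i := by
  simp [Nearer]

theorem Nearer.trans {i j l : ℕ} (h₁ : Nearer X x i j) (h₂ : Nearer X x j l) :
    Nearer X x i l := by
  unfold Nearer at *
  grind

theorem Nearer.trichotomy (i j : ℕ) : Nearer X x i j ∨ i = j ∨ Nearer X x j i := by
  unfold Nearer
  grind

open Classical in
theorem neighborRank_eq_card (i : ℕ) :
    neighborRank X S x i = (S.filter fun l => Nearer X x l i).card := by
  unfold neighborRank Nearer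
  congr!

theorem neighborRank_lt_of_nearer {i j : ℕ} (hi : i ∈ S) (h : Nearer X x i j) :
    neighborRank X S x i < neighborRank X S x j := by
  classical
  rw [neighborRank_eq_card, neighborRank_eq_card]
  refine Finset.card_lt_card ((Finset.ssubset_iff_of_subset ?_).2 ⟨i, ?_, ?_⟩)
  · intro l hl
    rw [Finset.mem_filter] at hl ⊢
    exact ⟨hl.1, hl.2.trans h⟩
  · exact Finset.mem_filter.2 ⟨hi, h⟩
  · simp [Nearer.irrefl]

theorem neighborRank_lt_iff {i j : ℕ} (hi : i ∈ S) (hj : j ∈ S) :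
    neighborRank X S x i < neighborRank X S x j ↔ Nearer X x i j := by
  refine ⟨fun h => ?_, neighborRank_lt_of_nearer hi⟩
  rcases Nearer.trichotomy (X := X) (x := x) i j with h' | rfl | h'
  · exact h'
  · exact absurd h (lt_irrefl _)
  · exact absurd h (neighborRank_lt_of_nearer hj h').not_gt

theorem neighborRank_injOn : Set.InjOn (neighborRank X S x) S := by
  intro i hi j hj h
  rcases Nearer.trichotomy (X := X) (x := x) i j with h' | h' | h'
  · exact absurd h (neighborRank_lt_of_nearer hi h').ne
  · exact h'
  · exact absurd h (neighborRank_lt_of_nearer hj h').ne'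

theorem neighborRank_lt_card {i : ℕ} (hi : i ∈ S) : neighborRank X S x i < S.card := by
  classical
  rw [neighborRank_eq_card]
  refine Finset.card_lt_card ((Finset.ssubset_iff_of_subset (Finset.filter_subset _ _)).2
    ⟨i, hi, ?_⟩)
  simp [Nearer.irrefl]

/-- Ties are broken by time, so the ranks are distinct numbers below |S| and therefore exhaust them.
-/
theorem image_neighborRank : S.image (neighborRank X S x) = Finset.range S.card := by
  apply Finset.eq_of_subset_of_card_le
  · intro n hn
    obtain ⟨i, hi, rfl⟩ := Finset.mem_image.1 hn
    exact Finset.mem_range.2 (neighborRank_lt_card hi)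
  · rw [Finset.card_image_of_injOn neighborRank_injOn, Finset.card_range]

theorem exists_neighborRank_eq {n : ℕ} (hn : n < S.card) : ∃ i ∈ S, neighborRank X S x i = n := by
  have : n ∈ S.image (neighborRank X S x) := by
    rw [image_neighborRank]
    exact Finset.mem_range.2 hn
  simpa using this

theorem nearest_subset (k : ℕ) : nearest X S x k ⊆ S := Finset.filter_subset _ _

theorem card_nearest {k : ℕ} (hk : k ≤ S.card) : (nearest X S x k).card = k := by
  classical
  have himg : (nearest X S x k).image (neighborRank X S x) = Finset.range k := by
    ext n
    simp only [nearest, Finset.mem_image, Finset.mem_filter, Finset.mem_range]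
    constructor
    · rintro ⟨i, ⟨-, hi⟩, rfl⟩
      exact hi
    · intro hn
      obtain ⟨i, hi, rfl⟩ := exists_neighborRank_eq (X := X) (x := x) (hn.trans_le hk)
      exact ⟨i, ⟨hi, hn⟩, rfl⟩
  have hinj : Set.InjOn (neighborRank X S x) (nearest X S x k) :=
    neighborRank_injOn.mono (Finset.coe_subset.2 (nearest_subset k))
  have hcard := Finset.card_image_of_injOn hinj
  rw [himg, Finset.card_range] at hcard
  exact hcard.symm

open Classical in
/-- The nearest neighbors are the samples not farther than some sample. -/
theorem exists_nearest_eq {k : ℕ} (hk : 1 ≤ k) (hkS : k ≤ S.card) :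
    ∃ j ∈ S, nearest X S x k = S.filter fun i => ¬ Nearer X x j i := by
  -- Ranks count from zero: the farthest of the k neighbors has rank k - 1.
  obtain ⟨j, hj, hjk⟩ := exists_neighborRank_eq (X := X) (x := x) (S := S) (n := k - 1) (by omega)
  refine ⟨j, hj, Finset.filter_congr fun i hi => ?_⟩
  rw [← neighborRank_lt_iff hj hi, hjk]
  omega

theorem dist_le_knnDist {i j : ℕ} (hi : i ∈ nearest X S x j) :
    dist (X i) x ≤ knnDist X S x j := by
  rw [dist_nndist, NNReal.coe_le_coe]
  exact Finset.le_sup (f := fun i => nndist (X i) x) hi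

-- A sample farther than r is preceded by all samples within r, so its rank is at least j and it is
-- not among the j nearest.
open Classical in
theorem knnDist_le {j : ℕ} {r : ℝ} (hr : 0 ≤ r)
    (hj : j ≤ (S.filter fun i => dist (X i) x ≤ r).card) : (knnDist X S x j : ℝ) ≤ r := by
  lift r to ℝ≥0 using hr
  rw [NNReal.coe_le_coe]
  refine Finset.sup_le fun i hi => ?_
  rw [← NNReal.coe_le_coe, ← dist_nndist]
  by_contra! hlt
  have hrank : neighborRank X S x i < j := (Finset.mem_filter.1 hi).2
  rw [neighborRank_eq_card] at hrank
  refine (hrank.trans_le hj).not_ge (Finset.card_le_card fun l hl => ?_)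
  rw [Finset.mem_filter] at hl ⊢
  exact ⟨hl.1, Or.inl (hl.2.trans_lt hlt)⟩

theorem le_adaptiveK {L : ℝ≥0} {T j : ℕ} (hj : 1 ≤ j) (hjS : j ≤ S.card)
    (h : (L : ℝ) * knnDist X S x j ≤ √(Real.log T / j)) : j ≤ adaptiveK L T X S x := by
  classical
  exact Finset.le_sup (f := id) (Finset.mem_filter.2 ⟨Finset.mem_Icc.2 ⟨hj, hjS⟩, h⟩)

/-- The index 1 is admissible, so the supremum is attained and is not the default 0 of an empty set.
-/
theorem adaptiveK_spec {L : ℝ≥0} {T : ℕ} (hS : S.Nonempty)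
    (h : (L : ℝ) * knnDist X S x 1 ≤ √(Real.log T)) :
    1 ≤ adaptiveK L T X S x ∧ adaptiveK L T X S x ≤ S.card ∧
      (L : ℝ) * knnDist X S x (adaptiveK L T X S x) ≤
        √(Real.log T / adaptiveK L T X S x) := by
  classical
  set F := (Finset.Icc 1 S.card).filter fun j =>
    (L : ℝ) * knnDist X S x j ≤ √(Real.log T / j) with hF
  have h1 : (1 : ℕ) ∈ F := by
    rw [hF, Finset.mem_filter, Finset.mem_Icc]
    refine ⟨⟨le_rfl, hS.card_pos⟩, ?_⟩
    simpa using h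
  obtain ⟨k, hk, hk'⟩ := Finset.exists_mem_eq_sup F ⟨1, h1⟩ id
  have hK : adaptiveK L T X S x = k := by
    rw [adaptiveK]
    exact hk'
  rw [hK]
  rw [hF, Finset.mem_filter, Finset.mem_Icc] at hk
  exact ⟨hk.1.1, hk.1.2, hk.2⟩

end Neighbors

/-! ## The gap of the chosen action when the noise is under control -/

theorem mem_samples {𝒜 : Type u} {A : ℕ → 𝒜} {t i : ℕ} {a : 𝒜} :
    i ∈ samples A t a ↔ i < t ∧ A i = a := by
  classical
  simp [samples]

section Trajectory

variable {𝒜 : Type u} [Fintype 𝒜] {d : ℕ}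

theorem le_bestReward (η : 𝒜 → EuclideanSpace ℝ (Fin d) → ℝ) (a : 𝒜)
    (x : EuclideanSpace ℝ (Fin d)) : η a x ≤ bestReward η x :=
  le_ciSup (Set.finite_range fun a => η a x).bddAbove a

theorem gap_nonneg (η : 𝒜 → EuclideanSpace ℝ (Fin d) → ℝ) (a : 𝒜)
    (x : EuclideanSpace ℝ (Fin d)) : 0 ≤ gap η a x :=
  sub_nonneg.2 (le_bestReward η a x)

theorem exists_eq_bestReward [Nonempty 𝒜] (η : 𝒜 → EuclideanSpace ℝ (Fin d) → ℝ)
    (x : EuclideanSpace ℝ (Fin d)) : ∃ a, η a x = bestReward η x :=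
  exists_eq_ciSup_of_finite

theorem abs_bestReward_sub_le [Nonempty 𝒜] {L : ℝ≥0} {η : 𝒜 → EuclideanSpace ℝ (Fin d) → ℝ}
    (hη : ∀ a, LipschitzWith L (η a)) (x y : EuclideanSpace ℝ (Fin d)) :
    |bestReward η x - bestReward η y| ≤ L * dist x y := by
  have key : ∀ x y, bestReward η x - bestReward η y ≤ L * dist x y := fun x y => by
    obtain ⟨a, ha⟩ := exists_eq_bestReward η x
    have h1 := (abs_le.1 ((Real.dist_eq _ _).symm.trans_le ((hη a).dist_le_mul x y))).2
    have h2 := le_bestReward η a y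
    linarith
  refine abs_sub_le_iff.2 ⟨key x y, ?_⟩
  rw [dist_comm]
  exact key y x

theorem abs_gap_sub_le [Nonempty 𝒜] {L : ℝ≥0} {η : 𝒜 → EuclideanSpace ℝ (Fin d) → ℝ}
    (hη : ∀ a, LipschitzWith L (η a)) (a : 𝒜) (x y : EuclideanSpace ℝ (Fin d)) :
    |gap η a x - gap η a y| ≤ 2 * L * dist x y := by
  have h1 := abs_le.1 (abs_bestReward_sub_le hη x y)
  have h2 := abs_le.1 ((Real.dist_eq _ _).symm.trans_le ((hη a).dist_le_mul x y))
  unfold gap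
  rw [abs_le]
  constructor <;> linarith [h1.1, h1.2, h2.1, h2.2]

/-- The sums of the noise over nearest neighbors obey the subgaussian deviation bounds that
the exploration bonus accounts for. -/
def NoiseControlled (σ : ℝ≥0) (T : ℕ) (η : 𝒜 → EuclideanSpace ℝ (Fin d) → ℝ)
    (X : ℕ → EuclideanSpace ℝ (Fin d)) (A : ℕ → 𝒜) (Y : ℕ → ℝ) : Prop :=
  ∀ t < T, ∀ a : 𝒜, ∀ k, 1 ≤ k → k ≤ (samples A t a).card →
    |∑ i ∈ nearest X (samples A t a) (X t) k, (Y i - η (A i) (X i))| ≤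
      √(2 * (σ : ℝ) ^ 2 * k * Real.log (d * (T : ℝ) ^ (2 * d + 3) * Fintype.card 𝒜))

variable {σ L : ℝ≥0} {T : ℕ} {η : 𝒜 → EuclideanSpace ℝ (Fin d) → ℝ}
  {X : ℕ → EuclideanSpace ℝ (Fin d)} {A : ℕ → 𝒜} {Y : ℕ → ℝ}

/-- The error splits into the averaged noise, covered by the bonus, and the bias, covered by the
Lipschitz condition at the farthest neighbor. -/
theorem abs_mean_sub_le (hη : ∀ a, LipschitzWith L (η a)) (hG : NoiseControlled σ T η X A Y)
    {t k : ℕ} (ht : t < T) (a : 𝒜) (hk : 1 ≤ k) (hkS : k ≤ (samples A t a).card) :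
    |(∑ i ∈ nearest X (samples A t a) (X t) k, Y i) / k - η a (X t)| ≤
      explorationBonus d σ T (Fintype.card 𝒜) k +
        L * knnDist X (samples A t a) (X t) k := by
  set N := nearest X (samples A t a) (X t) k with hN
  have hcard : N.card = k := card_nearest hkS
  have hk0 : (0 : ℝ) < k := by exact_mod_cast hk
  set Λ := Real.log (d * (T : ℝ) ^ (2 * d + 3) * Fintype.card 𝒜) with hΛ
  have hdecomp : (∑ i ∈ N, Y i) / k - η a (X t) =
      (∑ i ∈ N, (Y i - η (A i) (X i))) / k + (∑ i ∈ N, (η a (X i) - η a (X t))) / k := by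
    have h1 : ∑ i ∈ N, (Y i - η (A i) (X i)) = ∑ i ∈ N, (Y i - η a (X i)) := by
      refine Finset.sum_congr rfl fun i hi => ?_
      rw [(mem_samples.1 (nearest_subset k hi)).2]
    rw [h1, ← add_div, ← Finset.sum_add_distrib]
    simp only [sub_add_sub_cancel, Finset.sum_sub_distrib, Finset.sum_const, hcard, nsmul_eq_mul]
    field_simp
  have hbonus : |(∑ i ∈ N, (Y i - η (A i) (X i))) / k| ≤
      explorationBonus d σ T (Fintype.card 𝒜) k := by
    rw [abs_div, abs_of_pos hk0, div_le_iff₀ hk0]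
    refine (hG t ht a k hk hkS).trans (le_of_eq ?_)
    rw [explorationBonus, ← hΛ, show 2 * (σ : ℝ) ^ 2 * k * Λ = 2 * (σ : ℝ) ^ 2 / k * Λ * (k : ℝ) ^ 2
      by field_simp, Real.sqrt_mul' _ (sq_nonneg _), Real.sqrt_sq hk0.le]
  have hbias : |(∑ i ∈ N, (η a (X i) - η a (X t))) / k| ≤
      L * knnDist X (samples A t a) (X t) k := by
    rw [abs_div, abs_of_pos hk0, div_le_iff₀ hk0]
    refine (Finset.abs_sum_le_sum_abs _ _).trans ?_
    calc ∑ i ∈ N, |η a (X i) - η a (X t)|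
        ≤ ∑ i ∈ N, (L : ℝ) * knnDist X (samples A t a) (X t) k := by
          refine Finset.sum_le_sum fun i hi => ?_
          rw [← Real.dist_eq]
          exact ((hη a).dist_le_mul _ _).trans
            (mul_le_mul_of_nonneg_left (dist_le_knnDist hi) L.2)
      _ = _ := by rw [Finset.sum_const, hcard, nsmul_eq_mul, mul_comm]
  rw [hdecomp]
  exact (abs_add_le _ _).trans (add_le_add hbonus hbias)

theorem le_ucb (hη : ∀ a, LipschitzWith L (η a)) (hG : NoiseControlled σ T η X A Y)
    {t : ℕ} (ht : t < T) (a : 𝒜) : (η a (X t) : EReal) ≤ ucb σ L T X A Y t a (X t) := by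
  unfold ucb
  dsimp only
  split_ifs with h
  · exact le_top
  · push Not at h
    obtain ⟨h1, h2, -⟩ := adaptiveK_spec h.1 h.2
    have := (abs_le.1 (abs_mean_sub_le hη hG ht a h1 h2)).1
    rw [EReal.coe_le_coe_iff]
    linarith

/-- The gap of the chosen action is at most twice the width of its confidence bound. -/
theorem gap_le_width [Nonempty 𝒜] (hη : ∀ a, LipschitzWith L (η a))
    (hG : NoiseControlled σ T η X A Y) (hF : FollowsAdaptiveUCB σ L T X A Y)
    {t : ℕ} (ht : t < T) (hS : (samples A t (A t)).Nonempty)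
    (h1 : (L : ℝ) * knnDist X (samples A t (A t)) (X t) 1 ≤ √(Real.log T)) :
    gap η (A t) (X t) ≤
      2 * explorationBonus d σ T (Fintype.card 𝒜)
        (adaptiveK L T X (samples A t (A t)) (X t)) +
      2 * (L * knnDist X (samples A t (A t)) (X t)
        (adaptiveK L T X (samples A t (A t)) (X t))) := by
  obtain ⟨b, hb⟩ := exists_eq_bestReward η (X t)
  obtain ⟨hk1, hkS, -⟩ := adaptiveK_spec hS h1
  -- Optimism for a best action `b` and maximality of the chosen index.
  have hle := (le_ucb hη hG ht b).trans (hF t ht b)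
  have hucb : ucb σ L T X A Y t (A t) (X t) = _ := if_neg (by
    push Not
    exact ⟨hS, h1⟩)
  rw [hucb, EReal.coe_le_coe_iff, hb] at hle
  have := (abs_le.1 (abs_mean_sub_le hη hG ht (A t) hk1 hkS)).2
  unfold gap
  linarith

/-- The gap of the chosen action is at most `gapFactor d σ` times `√(ln T / k)`. -/
noncomputable def gapFactor (d : ℕ) (σ : ℝ≥0) : ℝ := 2 * √(2 * (σ : ℝ) ^ 2 * (4 * d + 4)) + 2

theorem gapFactor_pos (d : ℕ) (σ : ℝ≥0) : 0 < gapFactor d σ := by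
  unfold gapFactor
  positivity

theorem half_lt_log {T : ℕ} (hT : 2 ≤ T) : 1 / 2 < Real.log T := by
  have h : Real.log 2 ≤ Real.log T := Real.log_le_log two_pos (by exact_mod_cast hT)
  linarith [Real.log_two_gt_d9]

/-- Beyond (2d+3) ln T, the factor n adds at most ln T, and ln d ≤ d ≤ 2d ln T because ln T > 1/2.
-/
theorem log_confidence_le {d T n : ℕ} (hd : 1 ≤ d) (hT : 2 ≤ T) (hn : 1 ≤ n) (hnT : n ≤ T) :
    Real.log (d * (T : ℝ) ^ (2 * d + 3) * n) ≤ (4 * d + 4) * Real.log T := by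
  have hd0 : (0 : ℝ) < d := by exact_mod_cast hd
  have hT0 : (0 : ℝ) < T := by positivity
  have hn0 : (0 : ℝ) < n := by exact_mod_cast hn
  rw [Real.log_mul (by positivity) hn0.ne', Real.log_mul hd0.ne' (by positivity), Real.log_pow]
  have h1 : Real.log n ≤ Real.log T := Real.log_le_log hn0 (by exact_mod_cast hnT)
  have h2 : Real.log d ≤ d - 1 := Real.log_le_sub_one_of_pos hd0
  have h3 := mul_le_mul_of_nonneg_left (half_lt_log hT).le hd0.le
  push_cast
  linarith

/-- The choice of k bounds the distance term by √(ln T / k), the order of the bonus. -/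
theorem gap_le_gapFactor_mul [Nonempty 𝒜] (hd : 1 ≤ d) (hT : 2 ≤ T) (hcard : Fintype.card 𝒜 ≤ T)
    (hη : ∀ a, LipschitzWith L (η a))
    (hG : NoiseControlled σ T η X A Y) (hF : FollowsAdaptiveUCB σ L T X A Y)
    {t : ℕ} (ht : t < T) (hS : (samples A t (A t)).Nonempty)
    (h1 : (L : ℝ) * knnDist X (samples A t (A t)) (X t) 1 ≤ √(Real.log T)) :
    gap η (A t) (X t) ≤
      gapFactor d σ * √(Real.log T / adaptiveK L T X (samples A t (A t)) (X t)) := by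
  refine (gap_le_width hη hG hF ht hS h1).trans ?_
  obtain ⟨hk1, hkS, hk⟩ := adaptiveK_spec hS h1
  set k := adaptiveK L T X (samples A t (A t)) (X t)
  have hk0 : (0 : ℝ) < k := by exact_mod_cast hk1
  have hb : explorationBonus d σ T (Fintype.card 𝒜) k ≤
      √(2 * (σ : ℝ) ^ 2 * (4 * d + 4)) * √(Real.log T / k) := by
    rw [explorationBonus, ← Real.sqrt_mul (by positivity)]
    refine Real.sqrt_le_sqrt ?_
    calc 2 * (σ : ℝ) ^ 2 / k * Real.log (d * (T : ℝ) ^ (2 * d + 3) * Fintype.card 𝒜)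
        ≤ 2 * (σ : ℝ) ^ 2 / k * ((4 * d + 4) * Real.log T) :=
          mul_le_mul_of_nonneg_left (log_confidence_le hd hT Fintype.card_pos hcard)
            (by positivity)
      _ = _ := by ring
  unfold gapFactor
  linarith

open Classical in
/-- If the chosen action has gap at least `Δ`, it has few samples near the context. -/
theorem card_near_lt [Nonempty 𝒜] (hd : 1 ≤ d) (hT : 2 ≤ T) (hcard : Fintype.card 𝒜 ≤ T)
    (hη : ∀ a, LipschitzWith L (η a))
    (hG : NoiseControlled σ T η X A Y) (hF : FollowsAdaptiveUCB σ L T X A Y)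
    {t j : ℕ} (ht : t < T) {Δ r : ℝ} (hΔ : 0 < Δ) (hr : 0 ≤ r) (hj1 : 1 ≤ j)
    (hj : gapFactor d σ ^ 2 * Real.log T < j * Δ ^ 2) (hrj : L * r ≤ √(Real.log T / j))
    (hgap : Δ ≤ gap η (A t) (X t)) :
    ((samples A t (A t)).filter fun i => dist (X i) (X t) ≤ r).card < j := by
  -- With j samples within r, the index j is admissible by `hrj`. Then k ≥ j bounds the gap by
  -- `gapFactor d σ` times √(ln T / j), which `hj` makes smaller than Δ.
  by_contra! hn
  have hlog : 0 < Real.log T := by linarith [half_lt_log hT]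
  have hj0 : (0 : ℝ) < j := by exact_mod_cast hj1
  have hS : (samples A t (A t)).Nonempty := by
    obtain ⟨i, hi⟩ := Finset.card_pos.1 (lt_of_lt_of_le hj1 hn)
    exact ⟨i, (Finset.mem_filter.1 hi).1⟩
  have h1 : (L : ℝ) * knnDist X (samples A t (A t)) (X t) 1 ≤ √(Real.log T) := by
    refine (mul_le_mul_of_nonneg_left (knnDist_le hr (hj1.trans hn)) L.2).trans (hrj.trans ?_)
    refine Real.sqrt_le_sqrt (div_le_self hlog.le ?_)
    exact_mod_cast hj1
  have hjk : j ≤ adaptiveK L T X (samples A t (A t)) (X t) :=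
    le_adaptiveK hj1 (hn.trans (Finset.card_filter_le _ _))
      ((mul_le_mul_of_nonneg_left (knnDist_le hr hn) L.2).trans hrj)
  have hle := hgap.trans (gap_le_gapFactor_mul hd hT hcard hη hG hF ht hS h1)
  have hle2 : Δ ≤ gapFactor d σ * √(Real.log T / j) := by
    refine hle.trans (mul_le_mul_of_nonneg_left (Real.sqrt_le_sqrt ?_) (gapFactor_pos d σ).le)
    exact div_le_div_of_nonneg_left hlog.le hj0 (by exact_mod_cast hjk)
  have hsq := pow_le_pow_left₀ hΔ.le hle2 2
  rw [mul_pow, Real.sq_sqrt (by positivity), ← mul_div_assoc, le_div_iff₀ hj0] at hsq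
  linarith

end Trajectory

/-! ## Packing bounds for the number of large gaps -/

section Packing

theorem sum_biUnion_le_sum {ι κ : Type*} [DecidableEq κ] (I : Finset ι) (s : ι → Finset κ)
    {g : κ → ℝ} (hg : ∀ k, 0 ≤ g k) : ∑ k ∈ I.biUnion s, g k ≤ ∑ i ∈ I, ∑ k ∈ s i, g k := by
  classical
  induction I using Finset.induction_on with
  | empty => simp
  | insert i I hi ih =>
    rw [Finset.biUnion_insert, Finset.sum_insert hi]
    have h := Finset.sum_union_inter (s₁ := s i) (s₂ := I.biUnion s) (f := g)
    have h0 : 0 ≤ ∑ k ∈ s i ∩ I.biUnion s, g k := Finset.sum_nonneg fun k _ => hg k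
    linarith

open Classical in
/-- If every point of a finite sequence has fewer than `j` predecessors within distance `r`, then
the balls of radius `r / 2` around the points overlap at most `j` times. -/
theorem sum_measure_ball_le {E : Type*} [PseudoMetricSpace E] [MeasurableSpace E] [BorelSpace E]
    (ν : Measure E) (x : ℕ → E) (I : Finset ℕ) (U : Set E) (r : ℝ) (j : ℕ)
    (hI : ∀ t ∈ I, (I.filter fun i => i < t ∧ dist (x i) (x t) ≤ r).card < j)
    (hU : ∀ t ∈ I, Metric.ball (x t) (r / 2) ⊆ U) :
    ∑ t ∈ I, ν (Metric.ball (x t) (r / 2)) ≤ j * ν U := by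
  -- The sum of the masses is the integral of the overlap count, which is then bounded pointwise.
  have h1 : ∑ t ∈ I, ν (Metric.ball (x t) (r / 2)) =
      ∫⁻ y, ∑ t ∈ I, (Metric.ball (x t) (r / 2)).indicator (fun _ => (1 : ℝ≥0∞)) y ∂ν := by
    rw [lintegral_finsetSum _ fun t _ => measurable_const.indicator measurableSet_ball]
    refine Finset.sum_congr rfl fun t _ => ?_
    rw [lintegral_indicator_const measurableSet_ball, one_mul]
  rw [h1]
  refine le_trans (lintegral_mono fun y => ?_) (lintegral_indicator_const_le U (j : ℝ≥0∞))
  simp only [Set.indicator_apply]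
  rw [← Finset.sum_filter, Finset.sum_const, nsmul_eq_mul, mul_one]
  set F := I.filter fun t => y ∈ Metric.ball (x t) (r / 2) with hF
  rcases F.eq_empty_or_nonempty with h0 | hne
  · simp [h0]
  -- Compare with the latest ball containing y: the other centers are earlier and within r of its
  -- center, so there are fewer than j of them.
  have hmax := F.max'_mem hne
  set t := F.max' hne
  obtain ⟨htI, hty⟩ := Finset.mem_filter.1 hmax
  rw [if_pos (hU t htI hty)]
  have hsub : F.erase t ⊆ I.filter fun i => i < t ∧ dist (x i) (x t) ≤ r := by
    intro i hi
    obtain ⟨hit, hiF⟩ := Finset.mem_erase.1 hi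
    obtain ⟨hiI, hiy⟩ := Finset.mem_filter.1 hiF
    refine Finset.mem_filter.2 ⟨hiI, lt_of_le_of_ne (F.le_max' i hiF) hit, ?_⟩
    rw [Metric.mem_ball] at hiy hty
    linarith [dist_triangle_left (x i) (x t) y]
  have hle := (Finset.card_le_card hsub).trans_lt (hI t htI)
  rw [Finset.card_erase_of_mem hmax] at hle
  exact_mod_cast (by omega : F.card ≤ j)

end Packing

/-! ### Mass of small balls under the context distribution -/

section ContextLaw

variable {d : ℕ} {𝒳 : Set (EuclideanSpace ℝ (Fin d))} {f : EuclideanSpace ℝ (Fin d) → ℝ}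

theorem contextLaw_ball_ge (hf : IsContextDensity 𝒳 f) {c κ r₀ : ℝ} (hc : 0 < c) (hκ : 0 < κ)
    (hcf : ∀ x ∈ 𝒳, c ≤ f x) (hreg : IsVolumeRegular κ r₀ 𝒳) {x : EuclideanSpace ℝ (Fin d)}
    (hx : x ∈ 𝒳) {r : ℝ} (hr : 0 < r) (hr₀ : r ≤ r₀) :
    ENNReal.ofReal
        (c * κ * (volume : Measure (EuclideanSpace ℝ (Fin d))).real (Metric.ball 0 1) * r ^ d) ≤
      contextLaw 𝒳 f (Metric.ball x r) := by
  calc ENNReal.ofReal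
        (c * κ * (volume : Measure (EuclideanSpace ℝ (Fin d))).real (Metric.ball 0 1) * r ^ d)
      = ENNReal.ofReal c * (ENNReal.ofReal κ * volume (Metric.ball x r)) := by
        rw [Measure.addHaar_ball_of_pos _ _ hr, finrank_euclideanSpace_fin, measureReal_def,
          ENNReal.ofReal_mul (by positivity), ENNReal.ofReal_mul (by positivity),
          ENNReal.ofReal_mul hc.le, ENNReal.ofReal_toReal measure_ball_lt_top.ne]
        ring
    _ ≤ ENNReal.ofReal c * volume (𝒳 ∩ Metric.ball x r) := by
        gcongr
        exact hreg x hx r hr hr₀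
    _ = ∫⁻ _ in Metric.ball x r ∩ 𝒳, ENNReal.ofReal c := by
        rw [setLIntegral_const, Set.inter_comm]
    _ ≤ ∫⁻ y in Metric.ball x r ∩ 𝒳, ENNReal.ofReal (f y) :=
        setLIntegral_mono' (measurableSet_ball.inter hf.measurableSet)
          fun y hy => ENNReal.ofReal_le_ofReal (hcf y hy.2)
    _ = contextLaw 𝒳 f (Metric.ball x r) := by
        rw [contextLaw, withDensity_apply _ measurableSet_ball,
          Measure.restrict_restrict measurableSet_ball]

theorem volume_real_ball_pos :
    0 < (volume : Measure (EuclideanSpace ℝ (Fin d))).real (Metric.ball 0 1) :=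
  ENNReal.toReal_pos (Metric.measure_ball_pos _ _ one_pos).ne' measure_ball_lt_top.ne

end ContextLaw

/-! ### Regret on a trajectory with controlled noise -/

section LargeGaps

variable {𝒜 : Type u} [Fintype 𝒜] {d : ℕ} {𝒳 : Set (EuclideanSpace ℝ (Fin d))}
  {f : EuclideanSpace ℝ (Fin d) → ℝ} {σ L : ℝ≥0} {T : ℕ}
  {η : 𝒜 → EuclideanSpace ℝ (Fin d) → ℝ}
  {X : ℕ → EuclideanSpace ℝ (Fin d)} {A : ℕ → 𝒜} {Y : ℕ → ℝ}

/-- A bound for `Δ² / ln T` times the number of choices of a fixed action with gap about `Δ` and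
contexts near each other. -/
noncomputable def overlapFactor (d : ℕ) (σ : ℝ≥0) (M : ℝ) : ℝ := gapFactor d σ ^ 2 + 2 * M ^ 2

theorem one_le_overlapFactor {M : ℝ} (hM : 1 ≤ M) : 1 ≤ overlapFactor d σ M := by
  unfold overlapFactor
  nlinarith [sq_nonneg (gapFactor d σ)]

open Classical in
/-- The choices of action `a` before step `T` where its gap is in `[Δ, 2 Δ)`. -/
noncomputable def levelSteps (η : 𝒜 → EuclideanSpace ℝ (Fin d) → ℝ)
    (X : ℕ → EuclideanSpace ℝ (Fin d)) (A : ℕ → 𝒜) (T : ℕ) (a : 𝒜) (Δ : ℝ) : Finset ℕ :=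
  (Finset.range T).filter fun t => A t = a ∧ Δ ≤ gap η a (X t) ∧ gap η a (X t) < 2 * Δ

/-- Packing: balls around these contexts have mass bounded below, overlap at most j times, and fill
a set whose mass the margin condition bounds. -/
theorem card_levelSteps_le [Nonempty 𝒜] (hd : 1 ≤ d) (hT : 2 ≤ T) (hcard : Fintype.card 𝒜 ≤ T)
    (hf : IsContextDensity 𝒳 f) {α Cα c κ r₀ M ρ : ℝ} (hc : 0 < c) (hκ : 0 < κ)
    (hcf : ∀ x ∈ 𝒳, c ≤ f x) (hreg : IsVolumeRegular κ r₀ 𝒳) (hCα : 0 ≤ Cα)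
    (hmargin : TsybakovMargin α Cα 𝒳 f η) (hη : ∀ a, LipschitzWith L (η a))
    (hM : 1 ≤ M) (hρ : 0 < ρ) (hρr : ρ * M ≤ r₀) (hρL : L * ρ * overlapFactor d σ M ≤ 1 / 2)
    (hX : ∀ t < T, X t ∈ 𝒳) (hG : NoiseControlled σ T η X A Y)
    (hF : FollowsAdaptiveUCB σ L T X A Y) (a : 𝒜) {Δ : ℝ} (hΔ : 0 < Δ) (hΔM : Δ ≤ M) :
    (levelSteps η X A T a Δ).card *
        (c * κ * (volume : Measure (EuclideanSpace ℝ (Fin d))).real (Metric.ball 0 1) *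
          (ρ * Δ / 2) ^ d) ≤
      overlapFactor d σ M * Real.log T / Δ ^ 2 * (Cα * (4 * Δ) ^ α) := by
  classical
  set ω := (volume : Measure (EuclideanSpace ℝ (Fin d))).real (Metric.ball 0 1)
  have hω : 0 < ω := volume_real_ball_pos
  have hlog : 1 / 2 < Real.log T := half_lt_log hT
  set j : ℕ := ⌊gapFactor d σ ^ 2 * Real.log T / Δ ^ 2⌋₊ + 1 with hj
  have hj1 : 1 ≤ j := by omega
  have hj0 : (0 : ℝ) < j := by exact_mod_cast hj1
  have hjlow : gapFactor d σ ^ 2 * Real.log T < j * Δ ^ 2 := by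
    rw [← div_lt_iff₀ (by positivity), hj]
    push_cast
    exact Nat.lt_floor_add_one _
  have hjup : (j : ℝ) ≤ overlapFactor d σ M * Real.log T / Δ ^ 2 := by
    have h1 : (⌊gapFactor d σ ^ 2 * Real.log T / Δ ^ 2⌋₊ : ℝ) ≤
        gapFactor d σ ^ 2 * Real.log T / Δ ^ 2 := Nat.floor_le (by positivity)
    -- The summand 2 M² of `overlapFactor` absorbs the + 1 in j, because Δ ≤ M and ln T > 1/2.
    have h2 : 1 ≤ 2 * M ^ 2 * Real.log T / Δ ^ 2 := by
      rw [le_div_iff₀ (by positivity)]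
      have : Δ ^ 2 ≤ M ^ 2 := pow_le_pow_left₀ hΔ.le hΔM 2
      nlinarith [sq_nonneg M]
    rw [hj, overlapFactor, add_mul, add_div]
    push_cast
    exact add_le_add h1 h2
  have hO := one_le_overlapFactor (d := d) (σ := σ) hM
  have hLρ : L * ρ ≤ 1 / 2 :=
    (le_mul_of_one_le_right (mul_nonneg L.2 hρ.le) hO).trans hρL
  have hrj : L * (ρ * Δ) ≤ √(Real.log T / j) := by
    refine Real.le_sqrt_of_sq_le ?_
    rw [le_div_iff₀ hj0]
    have hLρ0 : 0 ≤ L * ρ := mul_nonneg L.2 hρ.le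
    calc (L * (ρ * Δ)) ^ 2 * j
        ≤ (L * (ρ * Δ)) ^ 2 * (overlapFactor d σ M * Real.log T / Δ ^ 2) := by gcongr
      _ = (L * ρ) * (L * ρ * overlapFactor d σ M) * Real.log T := by field_simp
      _ ≤ 1 * 1 * Real.log T := by
          gcongr
          · linarith
          · linarith
      _ = Real.log T := by ring
  set I := levelSteps η X A T a Δ with hIdef
  have hmem : ∀ t ∈ I, t < T ∧ A t = a ∧ Δ ≤ gap η a (X t) ∧ gap η a (X t) < 2 * Δ :=
    fun t ht => by simpa [hIdef, levelSteps] using ht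
  have hI : ∀ t ∈ I, (I.filter fun i => i < t ∧ dist (X i) (X t) ≤ ρ * Δ).card < j := by
    intro t ht
    obtain ⟨htT, hta, h1, -⟩ := hmem t ht
    refine lt_of_le_of_lt (Finset.card_le_card fun i hi => ?_)
      (card_near_lt hd hT hcard hη hG hF htT hΔ (by positivity) hj1 hjlow hrj (hta ▸ h1))
    obtain ⟨hiI, hit, hdist⟩ := Finset.mem_filter.1 hi
    exact Finset.mem_filter.2 ⟨mem_samples.2 ⟨hit, (hmem i hiI).2.1.trans hta.symm⟩, hdist⟩
  -- The gap is 2L-Lipschitz, so it varies by at most LρΔ ≤ Δ/2 from the center and stays positive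
  -- and below 4Δ.
  have hU : ∀ t ∈ I, Metric.ball (X t) (ρ * Δ / 2) ⊆
      {x | 0 < gap η a x ∧ gap η a x < 4 * Δ} := by
    intro t ht y hy
    obtain ⟨-, -, h1, h2⟩ := hmem t ht
    have h3 := abs_le.1 (abs_gap_sub_le hη a y (X t))
    have h4 : 2 * L * dist y (X t) ≤ Δ / 2 := by
      calc 2 * L * dist y (X t) ≤ 2 * L * (ρ * Δ / 2) := by
            gcongr
            exact (Metric.mem_ball.1 hy).le
        _ = L * ρ * Δ := by ring
        _ ≤ 1 / 2 * Δ := by gcongr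
        _ = Δ / 2 := by ring
    constructor <;> linarith [h3.1, h3.2]
  have hsum := sum_measure_ball_le (contextLaw 𝒳 f) X I _ (ρ * Δ) j hI hU
  have hball : ∀ t ∈ I, ENNReal.ofReal (c * κ * ω * (ρ * Δ / 2) ^ d) ≤
      contextLaw 𝒳 f (Metric.ball (X t) (ρ * Δ / 2)) := fun t ht =>
    contextLaw_ball_ge hf hc hκ hcf hreg (hX t (hmem t ht).1) (by positivity) (by nlinarith)
  have hfin := (Finset.card_nsmul_le_sum I _ _ hball).trans
    (hsum.trans (mul_le_mul_right (hmargin a (4 * Δ) (by positivity)) _))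
  rw [nsmul_eq_mul, ← ENNReal.ofReal_natCast, ← ENNReal.ofReal_natCast,
    ← ENNReal.ofReal_mul (by positivity), ← ENNReal.ofReal_mul (by positivity),
    ENNReal.ofReal_le_ofReal_iff (by positivity)] at hfin
  exact hfin.trans (by gcongr)

/-- The constant in the bound for the regret caused by one action at one level of its gap. -/
noncomputable def levelFactor (d : ℕ) (σ : ℝ≥0) (α Cα c κ M ρ : ℝ) : ℝ :=
  2 * overlapFactor d σ M * Cα * 4 ^ α /
    (c * κ * (volume : Measure (EuclideanSpace ℝ (Fin d))).real (Metric.ball 0 1) * (ρ / 2) ^ d)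

theorem levelFactor_nonneg {α Cα c κ M ρ : ℝ} (hc : 0 < c) (hκ : 0 < κ) (hCα : 0 ≤ Cα)
    (hρ : 0 < ρ) : 0 ≤ levelFactor d σ α Cα c κ M ρ := by
  unfold levelFactor overlapFactor
  positivity

theorem sum_levelSteps_le [Nonempty 𝒜] (hd : 1 ≤ d) (hT : 2 ≤ T) (hcard : Fintype.card 𝒜 ≤ T)
    (hf : IsContextDensity 𝒳 f) {α Cα c κ r₀ M ρ : ℝ} (hc : 0 < c) (hκ : 0 < κ)
    (hcf : ∀ x ∈ 𝒳, c ≤ f x) (hreg : IsVolumeRegular κ r₀ 𝒳) (hCα : 0 ≤ Cα)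
    (hmargin : TsybakovMargin α Cα 𝒳 f η) (hη : ∀ a, LipschitzWith L (η a))
    (hM : 1 ≤ M) (hgap : ∀ x ∈ 𝒳, ∀ a, gap η a x ≤ M)
    (hρ : 0 < ρ) (hρr : ρ * M ≤ r₀) (hρL : L * ρ * overlapFactor d σ M ≤ 1 / 2)
    (hX : ∀ t < T, X t ∈ 𝒳) (hG : NoiseControlled σ T η X A Y)
    (hF : FollowsAdaptiveUCB σ L T X A Y) (a : 𝒜) {Δ : ℝ} (hΔ : 0 < Δ) :
    ∑ t ∈ levelSteps η X A T a Δ, gap η (A t) (X t) ≤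
      levelFactor d σ α Cα c κ M ρ * Real.log T * Δ ^ (α - d - 1) := by
  classical
  have hlog : 1 / 2 < Real.log T := half_lt_log hT
  have hK := levelFactor_nonneg (d := d) (σ := σ) (α := α) (M := M) hc hκ hCα hρ
  have hmem : ∀ t ∈ levelSteps η X A T a Δ,
      t < T ∧ A t = a ∧ Δ ≤ gap η a (X t) ∧ gap η a (X t) < 2 * Δ :=
    fun t ht => by simpa [levelSteps] using ht
  rcases (levelSteps η X A T a Δ).eq_empty_or_nonempty with h0 | ⟨t₀, ht₀⟩
  · rw [h0, Finset.sum_empty]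
    positivity
  -- A nonempty level forces Δ ≤ M, which the counting bound needs.
  have hΔM : Δ ≤ M := (hmem t₀ ht₀).2.2.1.trans (hgap _ (hX t₀ (hmem t₀ ht₀).1) a)
  have hcount := card_levelSteps_le hd hT hcard hf hc hκ hcf hreg hCα hmargin hη hM hρ hρr hρL
    hX hG hF a hΔ hΔM
  have hω := volume_real_ball_pos (d := d)
  rw [← le_div_iff₀ (by positivity)] at hcount
  calc ∑ t ∈ levelSteps η X A T a Δ, gap η (A t) (X t)
      ≤ ∑ t ∈ levelSteps η X A T a Δ, 2 * Δ := by
        refine Finset.sum_le_sum fun t ht => ?_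
        obtain ⟨-, hta, -, h2⟩ := hmem t ht
        rw [hta]
        exact h2.le
    _ = (levelSteps η X A T a Δ).card * (2 * Δ) := by rw [Finset.sum_const, nsmul_eq_mul]
    _ ≤ _ := mul_le_mul_of_nonneg_right hcount (by positivity)
    _ = levelFactor d σ α Cα c κ M ρ * Real.log T * Δ ^ (α - d - 1) := by
        rw [Real.rpow_sub hΔ, Real.rpow_sub hΔ, Real.rpow_natCast, Real.rpow_one,
          Real.mul_rpow (by norm_num) hΔ.le, levelFactor, div_pow, div_pow, mul_pow]
        field_simp

open Classical in
/-- The regret of the choices of one action with gap at least `Δ`. -/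
theorem sum_large_gap_le [Nonempty 𝒜] (hd : 1 ≤ d) (hT : 2 ≤ T) (hcard : Fintype.card 𝒜 ≤ T)
    (hf : IsContextDensity 𝒳 f) {α Cα c κ r₀ M ρ : ℝ} (hα : α ≤ d) (hc : 0 < c) (hκ : 0 < κ)
    (hcf : ∀ x ∈ 𝒳, c ≤ f x) (hreg : IsVolumeRegular κ r₀ 𝒳) (hCα : 0 ≤ Cα)
    (hmargin : TsybakovMargin α Cα 𝒳 f η) (hη : ∀ a, LipschitzWith L (η a))
    (hM : 1 ≤ M) (hgap : ∀ x ∈ 𝒳, ∀ a, gap η a x ≤ M)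
    (hρ : 0 < ρ) (hρr : ρ * M ≤ r₀) (hρL : L * ρ * overlapFactor d σ M ≤ 1 / 2)
    (hX : ∀ t < T, X t ∈ 𝒳) (hG : NoiseControlled σ T η X A Y)
    (hF : FollowsAdaptiveUCB σ L T X A Y) (a : 𝒜) {Δ : ℝ} (hΔ : 0 < Δ) :
    ∑ t ∈ (Finset.range T).filter (fun t => A t = a ∧ Δ ≤ gap η a (X t)), gap η (A t) (X t) ≤
      2 * levelFactor d σ α Cα c κ M ρ * Real.log T * Δ ^ (α - d - 1) := by
  have hlog : 1 / 2 < Real.log T := half_lt_log hT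
  have hK := levelFactor_nonneg (d := d) (σ := σ) (α := α) (M := M) hc hκ hCα hρ
  -- No gap reaches 2^N Δ, so N dyadic levels suffice.
  obtain ⟨N, hN⟩ := pow_unbounded_of_one_lt (M / Δ) (one_lt_two (α := ℝ))
  rw [div_lt_iff₀ hΔ] at hN
  have hsub : (Finset.range T).filter (fun t => A t = a ∧ Δ ≤ gap η a (X t)) ⊆
      (Finset.range N).biUnion fun m => levelSteps η X A T a (2 ^ m * Δ) := by
    intro t ht
    obtain ⟨htT, hta, hle⟩ := Finset.mem_filter.1 ht
    obtain ⟨m, hm1, hm2⟩ := exists_nat_pow_near ((one_le_div hΔ).2 hle) (one_lt_two (α := ℝ))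
    rw [le_div_iff₀ hΔ] at hm1
    rw [div_lt_iff₀ hΔ] at hm2
    have hmN : m < N := by
      have h := hm1.trans_lt ((hgap _ (hX t (Finset.mem_range.1 htT)) a).trans_lt hN)
      exact (pow_lt_pow_iff_right₀ (one_lt_two (α := ℝ))).1 (lt_of_mul_lt_mul_right h hΔ.le)
    refine Finset.mem_biUnion.2 ⟨m, Finset.mem_range.2 hmN, ?_⟩
    refine Finset.mem_filter.2 ⟨htT, hta, hm1, ?_⟩
    rw [pow_succ] at hm2
    linarith
  -- Here α ≤ d enters: the exponent is at most -1, so the levels decay geometrically.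
  have hpow : ∀ m : ℕ, (2 ^ m * Δ) ^ (α - d - 1) ≤ (1 / 2) ^ m * Δ ^ (α - d - 1) := by
    intro m
    rw [Real.mul_rpow (by positivity) hΔ.le]
    gcongr
    rw [← Real.rpow_natCast 2 m, ← Real.rpow_mul two_pos.le, one_div, inv_pow,
      ← Real.rpow_natCast 2 m, ← Real.rpow_neg two_pos.le]
    refine Real.rpow_le_rpow_of_exponent_le one_lt_two.le ?_
    have : (0 : ℝ) ≤ m := Nat.cast_nonneg m
    nlinarith
  have hgeom : ∑ m ∈ Finset.range N, ((1 : ℝ) / 2) ^ m ≤ 2 := by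
    have := sum_geometric_two_le N
    simpa using this
  calc ∑ t ∈ (Finset.range T).filter (fun t => A t = a ∧ Δ ≤ gap η a (X t)), gap η (A t) (X t)
      ≤ ∑ t ∈ (Finset.range N).biUnion (fun m => levelSteps η X A T a (2 ^ m * Δ)),
          gap η (A t) (X t) :=
        Finset.sum_le_sum_of_subset_of_nonneg hsub fun t _ _ => gap_nonneg _ _ _
    _ ≤ ∑ m ∈ Finset.range N, ∑ t ∈ levelSteps η X A T a (2 ^ m * Δ), gap η (A t) (X t) :=
        sum_biUnion_le_sum _ _ fun t => gap_nonneg _ _ _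
    _ ≤ ∑ m ∈ Finset.range N,
          levelFactor d σ α Cα c κ M ρ * Real.log T * ((1 / 2) ^ m * Δ ^ (α - d - 1)) := by
        refine Finset.sum_le_sum fun m _ => ?_
        refine (sum_levelSteps_le hd hT hcard hf hc hκ hcf hreg hCα hmargin hη hM hgap hρ hρr hρL
          hX hG hF a (by positivity)).trans ?_
        exact mul_le_mul_of_nonneg_left (hpow m) (by positivity)
    _ = levelFactor d σ α Cα c κ M ρ * Real.log T * Δ ^ (α - d - 1) *
          ∑ m ∈ Finset.range N, ((1 : ℝ) / 2) ^ m := by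
        rw [Finset.mul_sum]
        refine Finset.sum_congr rfl fun m _ => by ring
    _ ≤ levelFactor d σ α Cα c κ M ρ * Real.log T * Δ ^ (α - d - 1) * 2 := by gcongr
    _ = _ := by ring

open Classical in
/-- The regret on a trajectory with controlled noise: the choices with gap at least `Δ` are few,
and those with a smaller gap are counted action by action. -/
theorem sum_gap_le [Nonempty 𝒜] (hd : 1 ≤ d) (hT : 2 ≤ T) (hcard : Fintype.card 𝒜 ≤ T)
    (hf : IsContextDensity 𝒳 f) {α Cα c κ r₀ M ρ : ℝ} (hα : α ≤ d) (hc : 0 < c) (hκ : 0 < κ)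
    (hcf : ∀ x ∈ 𝒳, c ≤ f x) (hreg : IsVolumeRegular κ r₀ 𝒳) (hCα : 0 ≤ Cα)
    (hmargin : TsybakovMargin α Cα 𝒳 f η) (hη : ∀ a, LipschitzWith L (η a))
    (hM : 1 ≤ M) (hgap : ∀ x ∈ 𝒳, ∀ a, gap η a x ≤ M)
    (hρ : 0 < ρ) (hρr : ρ * M ≤ r₀) (hρL : L * ρ * overlapFactor d σ M ≤ 1 / 2)
    (hX : ∀ t < T, X t ∈ 𝒳) (hG : NoiseControlled σ T η X A Y)
    (hF : FollowsAdaptiveUCB σ L T X A Y) {Δ : ℝ} (hΔ : 0 < Δ) :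
    ∑ t ∈ Finset.range T, gap η (A t) (X t) ≤
      Fintype.card 𝒜 *
          (2 * levelFactor d σ α Cα c κ M ρ * Real.log T * Δ ^ (α - d - 1)) +
        ∑ t ∈ Finset.range T, ∑ a,
          if 0 < gap η a (X t) ∧ gap η a (X t) < Δ then Δ else 0 := by
  have hlarge : ∑ t ∈ (Finset.range T).filter (fun t => Δ ≤ gap η (A t) (X t)),
      gap η (A t) (X t) ≤ Fintype.card 𝒜 *
        (2 * levelFactor d σ α Cα c κ M ρ * Real.log T * Δ ^ (α - d - 1)) := by
    rw [← Finset.sum_fiberwise _ A, ← Finset.card_univ, ← nsmul_eq_mul, ← Finset.sum_const]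
    refine Finset.sum_le_sum fun a _ => ?_
    refine le_of_eq_of_le (Finset.sum_congr ?_ fun _ _ => rfl)
      (sum_large_gap_le hd hT hcard hf hα hc hκ hcf hreg hCα hmargin hη hM hgap hρ hρr hρL
        hX hG hF a hΔ)
    rw [Finset.filter_filter]
    refine Finset.filter_congr fun t _ => ?_
    constructor
    · rintro ⟨h1, rfl⟩
      exact ⟨rfl, h1⟩
    · rintro ⟨rfl, h1⟩
      exact ⟨h1, rfl⟩
  have hsmall : ∑ t ∈ (Finset.range T).filter (fun t => ¬ Δ ≤ gap η (A t) (X t)),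
      gap η (A t) (X t) ≤ ∑ t ∈ Finset.range T, ∑ a,
          if 0 < gap η a (X t) ∧ gap η a (X t) < Δ then Δ else 0 := by
    -- The margin condition concerns a fixed action, whereas A_t is random; hence the sum over all
    -- actions. A zero gap contributes nothing.
    rw [Finset.sum_filter]
    refine Finset.sum_le_sum fun t _ => ?_
    have hterm : ∀ a ∈ Finset.univ,
        (0 : ℝ) ≤ if 0 < gap η a (X t) ∧ gap η a (X t) < Δ then Δ else 0 := fun a _ => by
      split_ifs <;> positivity
    refine le_trans ?_ (Finset.single_le_sum hterm (Finset.mem_univ (A t)))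
    have h0 := gap_nonneg η (A t) (X t)
    split_ifs <;> grind
  rw [← Finset.sum_filter_add_sum_filter_not _ fun t => Δ ≤ gap η (A t) (X t)]
  exact add_le_add hlarge hsmall

end LargeGaps

/-! ## Conditional bounds and supermartingales for nonnegative functions -/

section Conditional

variable {Ω : Type v} {mΩ : MeasurableSpace Ω} {μ : Measure Ω}

theorem generateFrom_image2_inter_eq_sup (m m' : MeasurableSpace Ω) :
    MeasurableSpace.generateFrom
      (Set.image2 (· ∩ ·) {s | MeasurableSet[m] s} {s | MeasurableSet[m'] s}) = m ⊔ m' := by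
  apply le_antisymm
  · refine MeasurableSpace.generateFrom_le ?_
    rintro _ ⟨s, hs, t, ht, rfl⟩
    exact MeasurableSet.inter (le_sup_left (a := m) (b := m') s hs)
      (le_sup_right (a := m) (b := m') t ht)
  · refine sup_le (fun s hs => ?_) fun t ht => ?_
    · exact MeasurableSpace.measurableSet_generateFrom
        ⟨s, hs, Set.univ, MeasurableSet.univ, Set.inter_univ s⟩
    · exact MeasurableSpace.measurableSet_generateFrom
        ⟨Set.univ, MeasurableSet.univ, t, ht, Set.univ_inter t⟩

theorem isPiSystem_image2_inter (m m' : MeasurableSpace Ω) :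
    IsPiSystem (Set.image2 (· ∩ ·) {s | MeasurableSet[m] s} {s | MeasurableSet[m'] s}) := by
  rintro _ ⟨s, hs, t, ht, rfl⟩ _ ⟨s', hs', t', ht', rfl⟩ -
  exact ⟨s ∩ s', MeasurableSet.inter hs hs', t ∩ t', MeasurableSet.inter ht ht',
    Set.inter_inter_inter_comm s s' t t'⟩

theorem setLIntegral_inter_of_indep [IsProbabilityMeasure μ] {p m' : MeasurableSpace Ω}
    (hp : p ≤ mΩ) (hm' : m' ≤ mΩ) (hind : Indep p m' μ) {h : Ω → ℝ≥0∞} (hh : Measurable[p] h)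
    {s t : Set Ω} (hs : MeasurableSet[p] s) (ht : MeasurableSet[m'] t) :
    ∫⁻ ω in s ∩ t, h ω ∂μ = (∫⁻ ω in s, h ω ∂μ) * μ t := by
  have hmul := lintegral_mul_eq_lintegral_mul_lintegral_of_independent_measurableSpace hp hm' hind
    (hh.indicator hs) (measurable_const.indicator ht : Measurable[m'] (t.indicator 1))
  rw [lintegral_indicator (hp s hs), lintegral_indicator_one (hm' t ht)] at hmul
  rw [← hmul, ← lintegral_indicator ((hp s hs).inter (hm' t ht))]
  refine lintegral_congr fun ω => ?_
  by_cases h1 : ω ∈ s <;> by_cases h2 : ω ∈ t <;> simp [h1, h2]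

/-- A conditional expectation does not change when an independent σ-algebra is adjoined. -/
theorem setLIntegral_eq_of_indep_sup [IsProbabilityMeasure μ] {m p m' : MeasurableSpace Ω}
    (hmp : m ≤ p) (hp : p ≤ mΩ) (hm' : m' ≤ mΩ) (hind : Indep p m' μ) {h g : Ω → ℝ≥0∞}
    (hh : Measurable[p] h) (hg : Measurable[m] g) (hfin : ∫⁻ ω, h ω ∂μ ≠ ∞)
    (heq : ∀ s, MeasurableSet[m] s → ∫⁻ ω in s, h ω ∂μ = ∫⁻ ω in s, g ω ∂μ)
    {s : Set Ω} (hs : MeasurableSet[m ⊔ m'] s) :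
    ∫⁻ ω in s, h ω ∂μ = ∫⁻ ω in s, g ω ∂μ := by
  have hsup : m ⊔ m' ≤ mΩ := sup_le (hmp.trans hp) hm'
  have huniv : ∫⁻ ω, h ω ∂μ = ∫⁻ ω, g ω ∂μ := by
    simpa using heq Set.univ MeasurableSet.univ
  have hfin_g : ∫⁻ ω, g ω ∂μ ≠ ∞ := huniv ▸ hfin
  -- On intersections a ∩ b independence splits off μ b. Finiteness of the integrals allows the
  -- subtraction for complements.
  induction s, hs using MeasurableSpace.induction_on_inter
    (generateFrom_image2_inter_eq_sup m m').symm (isPiSystem_image2_inter m m') with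
  | empty => simp
  | basic t ht =>
    obtain ⟨a, ha, b, hb, rfl⟩ := ht
    rw [setLIntegral_inter_of_indep hp hm' hind hh (hmp a ha) hb,
      setLIntegral_inter_of_indep hp hm' hind (hg.mono hmp le_rfl) (hmp a ha) hb, heq a ha]
  | compl t ht ih =>
    have h1 := lintegral_add_compl (μ := μ) h (hsup t ht)
    have h2 := lintegral_add_compl (μ := μ) g (hsup t ht)
    rw [ih, huniv, ← h2] at h1
    refine (ENNReal.add_right_inj ?_).1 h1
    exact ne_top_of_le_ne_top hfin_g (setLIntegral_le_lintegral _ _)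
  | iUnion F hdisj hF ih =>
    rw [lintegral_iUnion (fun i => hsup _ (hF i)) hdisj,
      lintegral_iUnion (fun i => hsup _ (hF i)) hdisj]
    exact tsum_congr ih

/-- A bound for integrals over the sets of a σ-algebra extends to the functions measurable for
it. -/
theorem lintegral_mul_le_of_setLIntegral_le {m : MeasurableSpace Ω} (hm : m ≤ mΩ)
    {h Z : Ω → ℝ≥0∞} (hh : Measurable[mΩ] h) (hZ : Measurable[m] Z)
    (hle : ∀ s, MeasurableSet[m] s → ∫⁻ ω in s, h ω ∂μ ≤ μ s) :
    ∫⁻ ω, Z ω * h ω ∂μ ≤ ∫⁻ ω, Z ω ∂μ := by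
  -- The hypothesis says that the measure with density h is at most μ on the σ-algebra m.
  have hmeas : (μ.withDensity h).trim hm ≤ μ.trim hm := by
    refine Measure.le_iff.2 fun s hs => ?_
    rw [trim_measurableSet_eq hm hs, trim_measurableSet_eq hm hs, withDensity_apply _ (hm s hs)]
    exact hle s hs
  calc ∫⁻ ω, Z ω * h ω ∂μ = ∫⁻ ω, (h * Z) ω ∂μ := by simp only [Pi.mul_apply, mul_comm]
    _ = ∫⁻ ω, Z ω ∂(μ.withDensity h) :=
      (lintegral_withDensity_eq_lintegral_mul μ hh (hZ.mono hm le_rfl)).symm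
    _ = ∫⁻ ω, Z ω ∂((μ.withDensity h).trim hm) := (lintegral_trim hm hZ).symm
    _ ≤ ∫⁻ ω, Z ω ∂(μ.trim hm) := lintegral_mono' hmeas le_rfl
    _ = ∫⁻ ω, Z ω ∂μ := lintegral_trim hm hZ

open Classical in
/-- The expectation of a product of nonnegative factors with conditional expectation at most one,
over a predictable set of indices, is at most one. -/
theorem lintegral_prod_le_one [IsProbabilityMeasure μ] (E : ℕ → MeasurableSpace Ω)
    (hEmono : Monotone E) (n : ℕ) (hE : ∀ i < n, E i ≤ mΩ) (B : ℕ → Set Ω)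
    (hB : ∀ i < n, MeasurableSet[E i] (B i)) (h : ℕ → Ω → ℝ≥0∞)
    (hh : ∀ i < n, Measurable (h i)) (hhE : ∀ i, i + 1 < n → Measurable[E (i + 1)] (h i))
    (hle : ∀ i < n, ∀ s, MeasurableSet[E i] s → ∫⁻ ω in s, h i ω ∂μ ≤ μ s) :
    ∫⁻ ω, ∏ i ∈ Finset.range n, (if ω ∈ B i then h i ω else 1) ∂μ ≤ 1 := by
  suffices H : ∀ k ≤ n, ∫⁻ ω, ∏ i ∈ Finset.range k, (if ω ∈ B i then h i ω else 1) ∂μ ≤ 1 from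
    H n le_rfl
  intro k
  induction k with
  | zero => simp
  | succ k ih =>
    intro hk
    refine le_trans ?_ (ih (by omega))
    have hZ : Measurable[E k] fun ω => ∏ i ∈ Finset.range k, (if ω ∈ B i then h i ω else 1) := by
      refine Finset.measurable_fun_prod _ fun i hi => ?_
      have hik : i < k := Finset.mem_range.1 hi
      refine Measurable.ite (hEmono hik.le _ (hB i (by omega))) ?_ measurable_const
      exact (hhE i (by omega)).mono (hEmono hik) le_rfl
    simp only [Finset.prod_range_succ]
    refine lintegral_mul_le_of_setLIntegral_le (hE k hk) ?_ hZ fun s hs => ?_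
    · exact Measurable.ite (hE k hk _ (hB k hk)) (hh k hk) measurable_const
    · have hBk := hE k hk _ (hB k hk)
      -- The last factor is controlled by `hle` on `B k` and equals 1 off it.
      rw [← lintegral_inter_add_sdiff _ s hBk]
      have h1 : ∫⁻ ω in s ∩ B k, (if ω ∈ B k then h k ω else 1) ∂μ ≤ μ (s ∩ B k) := by
        rw [setLIntegral_congr_fun (g := h k) ((hE k hk _ hs).inter hBk)
          fun ω hω => if_pos hω.2]
        exact hle k hk _ (MeasurableSet.inter hs (hB k hk))
      have h2 : ∫⁻ ω in s \ B k, (if ω ∈ B k then h k ω else 1) ∂μ = μ (s \ B k) := by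
        rw [setLIntegral_congr_fun (g := fun _ => 1) ((hE k hk _ hs).diff hBk)
          fun ω hω => if_neg hω.2]
        simp
      rw [h2]
      exact (add_le_add_left h1 _).trans (measure_inter_add_sdiff s hBk).le

end Conditional

/-! ## Deviation of the noise over nearest neighbors -/

section BanditProcess

variable {Ω : Type v} {𝒜 : Type u} {d : ℕ} {T : ℕ} {η : 𝒜 → EuclideanSpace ℝ (Fin d) → ℝ}
  {X : ℕ → Ω → EuclideanSpace ℝ (Fin d)} {A : ℕ → Ω → 𝒜} {Y : ℕ → Ω → ℝ}

theorem comap_context_le_pastSigma {i t : ℕ} (h : i < t) :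
    MeasurableSpace.comap (X i) inferInstance ≤ pastSigma X A Y t :=
  (le_sup_left.trans le_sup_left).trans (le_iSup₂ (f := fun i (_ : i < t) =>
    MeasurableSpace.comap (X i) inferInstance ⊔ MeasurableSpace.comap (A i) ⊤ ⊔
      MeasurableSpace.comap (Y i) inferInstance) i h)

theorem comap_action_le_pastSigma {i t : ℕ} (h : i < t) :
    MeasurableSpace.comap (A i) ⊤ ≤ pastSigma X A Y t :=
  (le_sup_right.trans le_sup_left).trans (le_iSup₂ (f := fun i (_ : i < t) =>
    MeasurableSpace.comap (X i) inferInstance ⊔ MeasurableSpace.comap (A i) ⊤ ⊔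
      MeasurableSpace.comap (Y i) inferInstance) i h)

theorem comap_reward_le_pastSigma {i t : ℕ} (h : i < t) :
    MeasurableSpace.comap (Y i) inferInstance ≤ pastSigma X A Y t :=
  le_sup_right.trans (le_iSup₂ (f := fun i (_ : i < t) =>
    MeasurableSpace.comap (X i) inferInstance ⊔ MeasurableSpace.comap (A i) ⊤ ⊔
      MeasurableSpace.comap (Y i) inferInstance) i h)

theorem pastSigma_mono {s t : ℕ} (h : s ≤ t) : pastSigma X A Y s ≤ pastSigma X A Y t :=
  iSup₂_le fun i hi => le_iSup₂ (f := fun i (_ : i < t) =>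
    MeasurableSpace.comap (X i) inferInstance ⊔ MeasurableSpace.comap (A i) ⊤ ⊔
      MeasurableSpace.comap (Y i) inferInstance) i (hi.trans_le h)

theorem decisionSigma_le_pastSigma {s t : ℕ} (h : s < t) :
    decisionSigma X A Y s ≤ pastSigma X A Y t :=
  sup_le (sup_le (pastSigma_mono h.le) (comap_context_le_pastSigma h))
    (comap_action_le_pastSigma h)

theorem decisionSigma_mono : Monotone (decisionSigma X A Y) := by
  intro s t h
  rcases h.eq_or_lt with rfl | h
  · exact le_rfl
  · exact (decisionSigma_le_pastSigma h).trans (le_sup_left.trans le_sup_left)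

theorem measurable_reward_function [Fintype 𝒜] (hη : ∀ a, Measurable (η a)) {m : MeasurableSpace Ω} {t : ℕ}
    (hX : MeasurableSpace.comap (X t) inferInstance ≤ m)
    (hA : MeasurableSpace.comap (A t) ⊤ ≤ m) :
    Measurable[m] fun ω => η (A t ω) (X t ω) := by
  classical
  have hsum : (fun ω => η (A t ω) (X t ω)) =
      fun ω => ∑ a, if ω ∈ A t ⁻¹' {a} then η a (X t ω) else 0 := by
    ext ω
    simp
  rw [hsum]
  refine Finset.measurable_fun_sum _ fun a _ => Measurable.ite (hA _ ⟨{a}, trivial, rfl⟩) ?_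
    measurable_const
  exact (hη a).comp (measurable_iff_comap_le.2 hX)

theorem measurable_noise [Fintype 𝒜] (hη : ∀ a, Measurable (η a)) {m : MeasurableSpace Ω} {t : ℕ}
    (hm : pastSigma X A Y (t + 1) ≤ m) : Measurable[m] (noise η X A Y t) :=
  Measurable.sub
    (measurable_iff_comap_le.2 ((comap_reward_le_pastSigma t.lt_succ_self).trans hm))
    (measurable_reward_function hη ((comap_context_le_pastSigma t.lt_succ_self).trans hm)
      ((comap_action_le_pastSigma t.lt_succ_self).trans hm))

/-- What precedes the reward of step `i`, together with all contexts. -/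
abbrev revealedSigma (X : ℕ → Ω → EuclideanSpace ℝ (Fin d)) (A : ℕ → Ω → 𝒜) (Y : ℕ → Ω → ℝ)
    (n i : ℕ) : MeasurableSpace Ω :=
  decisionSigma X A Y i ⊔ ⨆ (l : ℕ) (_ : l < n), MeasurableSpace.comap (X l) inferInstance

open Classical in
/-- The samples of action `a` before step `t` that are not farther from `X_t` than `X_j` is. -/
noncomputable def ballSamples (X : ℕ → Ω → EuclideanSpace ℝ (Fin d)) (A : ℕ → Ω → 𝒜)
    (t j : ℕ) (a : 𝒜) (ω : Ω) : Finset ℕ :=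
  (samples (fun i => A i ω) t a).filter fun i => ¬ Nearer (fun i => X i ω) (X t ω) j i

theorem mem_ballSamples {t j i : ℕ} {a : 𝒜} {ω : Ω} : i ∈ ballSamples X A t j a ω ↔
    i < t ∧ A i ω = a ∧ ¬ Nearer (fun i => X i ω) (X t ω) j i := by
  classical
  rw [ballSamples, Finset.mem_filter, mem_samples, and_assoc]

theorem measurableSet_mem_ballSamples {m : MeasurableSpace Ω} {t j i : ℕ} (ht : Measurable (X t))
    (hj : Measurable (X j)) (hi : Measurable (X i)) (a : 𝒜) (hA : MeasurableSet {ω | A i ω = a}) :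
    MeasurableSet {ω | i ∈ ballSamples X A t j a ω} := by
  have hdj : Measurable fun ω => dist (X j ω) (X t ω) := hj.dist ht
  have hdi : Measurable fun ω => dist (X i ω) (X t ω) := hi.dist ht
  simp only [mem_ballSamples, Nearer]
  refine MeasurableSet.inter (MeasurableSet.const _) (MeasurableSet.inter hA ?_)
  exact MeasurableSet.compl (MeasurableSet.union (measurableSet_lt hdj hdi)
    (MeasurableSet.inter (measurableSet_eq_fun hdj hdi) (MeasurableSet.const _)))

/-- Predictability: with all contexts revealed, membership of step i depends only on A_i, which is
known before its reward. -/
theorem measurableSet_mem_ballSamples_revealedSigma {t j i : ℕ} (ht : t < T) (hj : j < T)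
    (hi : i < T) (a : 𝒜) :
    MeasurableSet[revealedSigma X A Y T i] {ω | i ∈ ballSamples X A t j a ω} := by
  have hX : ∀ l < T, Measurable[revealedSigma X A Y T i] (X l) := fun l hl =>
    measurable_iff_comap_le.2 (le_sup_of_le_right (le_iSup₂ (f := fun l (_ : l < T) =>
      MeasurableSpace.comap (X l) inferInstance) l hl))
  exact measurableSet_mem_ballSamples (hX t ht) (hX j hj) (hX i hi) a
    ((le_sup_of_le_left le_sup_right : MeasurableSpace.comap (A i) ⊤ ≤ revealedSigma X A Y T i) _
      ⟨{a}, trivial, rfl⟩)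

/-- A set of nearest neighbors is determined by its farthest member j, so finitely many events,
indexed independently of the trajectory, suffice for a union bound. The size is k + 1 so that k
ranges below T. -/
theorem noise_controlled_of_forall [Fintype 𝒜] {σ : ℝ≥0} {ω : Ω}
    (h : ∀ t < T, ∀ a : 𝒜, ∀ j < T, ∀ k < T, ∀ b : Bool,
      ¬ ((ballSamples X A t j a ω).card = k + 1 ∧
        √(2 * (σ : ℝ) ^ 2 * (k + 1 : ℕ) *
            Real.log (d * (T : ℝ) ^ (2 * d + 3) * Fintype.card 𝒜)) <
          (if b then 1 else -1) * ∑ i ∈ ballSamples X A t j a ω, noise η X A Y i ω)) :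
    NoiseControlled σ T η (fun t => X t ω) (fun t => A t ω) (fun t => Y t ω) := by
  classical
  intro t ht a k hk hkS
  obtain ⟨j, hjS, hj⟩ := exists_nearest_eq (X := fun i => X i ω) (x := X t ω) hk hkS
  have hjT : j < T := (mem_samples.1 hjS).1.trans ht
  have hball : ballSamples X A t j a ω =
      nearest (fun i => X i ω) (samples (fun i => A i ω) t a) (X t ω) k := by
    rw [hj, ballSamples]
  have hkT : k - 1 < T := by
    have h1 : (samples (fun i => A i ω) t a).card ≤ t := by
      refine (Finset.card_le_card fun i hi => ?_).trans_eq (Finset.card_range t)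
      exact Finset.mem_range.2 (mem_samples.1 hi).1
    omega
  have hb : ∀ b : Bool, (if b then (1 : ℝ) else -1) *
      ∑ i ∈ ballSamples X A t j a ω, noise η X A Y i ω ≤
        √(2 * (σ : ℝ) ^ 2 * k * Real.log (d * (T : ℝ) ^ (2 * d + 3) * Fintype.card 𝒜)) := by
    intro b
    have h1 := h t ht a j hjT (k - 1) hkT b
    rw [Nat.sub_add_cancel hk] at h1
    by_contra! h2
    exact h1 ⟨by rw [hball, card_nearest hkS], h2⟩
  have h1 := hb true
  have h2 := hb false
  rw [hball] at h1 h2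
  rw [abs_le]
  simp only [if_true, Bool.false_eq_true, if_false, one_mul, neg_one_mul] at h1 h2
  exact ⟨by linarith! [h2], h1⟩

section

variable [mΩ : MeasurableSpace Ω] {μ : Measure Ω} {σ : ℝ≥0} {𝒳 : Set (EuclideanSpace ℝ (Fin d))}
  {f : EuclideanSpace ℝ (Fin d) → ℝ} [Fintype 𝒜]

theorem IsBanditProcess.comap_action_le (hP : IsBanditProcess μ σ T 𝒳 f η X A Y) {t : ℕ}
    (ht : t < T) : MeasurableSpace.comap (A t) ⊤ ≤ mΩ := by
  rintro _ ⟨s, -, rfl⟩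
  have hs : A t ⁻¹' s = ⋃ a ∈ s, {ω | A t ω = a} := by
    ext ω
    simp
  rw [hs]
  exact MeasurableSet.biUnion (Set.to_countable s) fun a _ => hP.measurable_action t ht a

theorem IsBanditProcess.pastSigma_le (hP : IsBanditProcess μ σ T 𝒳 f η X A Y) {t : ℕ}
    (ht : t ≤ T) : pastSigma X A Y t ≤ mΩ :=
  iSup₂_le fun i hi => sup_le (sup_le (hP.measurable_context i (hi.trans_le ht)).comap_le
    (hP.comap_action_le (hi.trans_le ht))) (hP.measurable_reward i (hi.trans_le ht)).comap_le

theorem IsBanditProcess.decisionSigma_le (hP : IsBanditProcess μ σ T 𝒳 f η X A Y) {t : ℕ}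
    (ht : t < T) : decisionSigma X A Y t ≤ mΩ :=
  (decisionSigma_le_pastSigma t.lt_succ_self).trans (hP.pastSigma_le ht)

/-- The conditional expectation given `decisionSigma` serves as g. Contexts are adjoined one at a
time: those up to step i are already known, and a later X_n is independent of the past at n, which
contains the noise of step i and all contexts adjoined so far. -/
theorem IsBanditProcess.exists_conditional_bound [IsProbabilityMeasure μ]
    (hP : IsBanditProcess μ σ T 𝒳 f η X A Y) (hη : ∀ a, Measurable (η a)) {i : ℕ} (hi : i < T)
    (s : ℝ) {n : ℕ} (hn : n ≤ T) :
    ∃ g : Ω → ℝ≥0∞, Measurable[decisionSigma X A Y i] g ∧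
      (∀ᵐ ω ∂μ, g ω ≤ ENNReal.ofReal (Real.exp (s ^ 2 * (σ : ℝ) ^ 2 / 2))) ∧
      ∀ S, MeasurableSet[revealedSigma X A Y n i] S →
        ∫⁻ ω in S, ENNReal.ofReal (Real.exp (s * noise η X A Y i ω)) ∂μ =
          ∫⁻ ω in S, g ω ∂μ := by
  have hD := hP.decisionSigma_le hi
  have hint := hP.noise_integrable i hi s
  set w : Ω → ℝ := fun ω => Real.exp (s * noise η X A Y i ω) with hw
  refine ⟨fun ω => ENNReal.ofReal ((μ[w|decisionSigma X A Y i]) ω),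
    ENNReal.measurable_ofReal.comp stronglyMeasurable_condExp.measurable, ?_, ?_⟩
  · filter_upwards [hP.noise_subgaussian i hi s] with ω hω
    exact ENNReal.ofReal_le_ofReal hω
  have hcond_nonneg : 0 ≤ᵐ[μ] μ[w|decisionSigma X A Y i] :=
    condExp_nonneg (Filter.Eventually.of_forall fun ω => (Real.exp_pos _).le)
  have hbase : ∀ S, MeasurableSet[decisionSigma X A Y i] S →
      ∫⁻ ω in S, ENNReal.ofReal (w ω) ∂μ =
        ∫⁻ ω in S, ENNReal.ofReal ((μ[w|decisionSigma X A Y i]) ω) ∂μ := by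
    intro S hS
    rw [← ofReal_integral_eq_lintegral_ofReal hint.integrableOn
        (Filter.Eventually.of_forall fun ω => (Real.exp_pos _).le),
      ← ofReal_integral_eq_lintegral_ofReal integrable_condExp.integrableOn
        (ae_restrict_of_ae hcond_nonneg), setIntegral_condExp hD hint hS]
  induction n with
  | zero =>
    intro S hS
    rw [revealedSigma, sup_eq_left.2 (iSup₂_le fun l hl => absurd hl l.not_lt_zero)] at hS
    exact hbase S hS
  | succ n ih =>
    have ih' := ih (by omega)
    intro S hS
    have hsplit : revealedSigma X A Y (n + 1) i =
        revealedSigma X A Y n i ⊔ MeasurableSpace.comap (X n) inferInstance := by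
      refine (congrArg (decisionSigma X A Y i ⊔ ·) ?_).trans (sup_assoc _ _ _).symm
      refine le_antisymm (iSup₂_le fun l hl => ?_) (sup_le (iSup₂_le fun l hl => ?_) ?_)
      · rcases (Nat.lt_succ_iff.1 hl).eq_or_lt with rfl | hl'
        · exact le_sup_right
        · exact le_sup_of_le_left (le_iSup₂ (f := fun l (_ : l < n) =>
            MeasurableSpace.comap (X l) inferInstance) l hl')
      · exact le_iSup₂ (f := fun l (_ : l < n + 1) =>
            MeasurableSpace.comap (X l) inferInstance) l (hl.trans n.lt_succ_self)
      · exact le_iSup₂ (f := fun l (_ : l < n + 1) =>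
            MeasurableSpace.comap (X l) inferInstance) n n.lt_succ_self
    rw [hsplit] at hS
    rcases le_or_gt n i with hni | hni
    · have hle : MeasurableSpace.comap (X n) inferInstance ≤ revealedSigma X A Y n i := by
        refine le_sup_of_le_left ?_
        rcases hni.eq_or_lt with rfl | hni
        · exact le_sup_right.trans le_sup_left
        · exact (comap_context_le_pastSigma hni).trans (le_sup_left.trans le_sup_left)
      rw [sup_eq_left.2 hle] at hS
      exact ih' S hS
    · have hle : revealedSigma X A Y n i ≤ pastSigma X A Y n :=
        sup_le (decisionSigma_le_pastSigma hni)
          (iSup₂_le fun l hl => comap_context_le_pastSigma hl)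
      refine setLIntegral_eq_of_indep_sup hle (hP.pastSigma_le (by omega))
        (hP.measurable_context n (by omega)).comap_le (hP.context_indep n (by omega)) ?_ ?_ ?_
        ih' hS
      · exact ENNReal.measurable_ofReal.comp (Real.measurable_exp.comp
          ((measurable_noise hη (pastSigma_mono hni)).const_mul s))
      · exact (ENNReal.measurable_ofReal.comp
          stronglyMeasurable_condExp.measurable).mono le_sup_left le_rfl
      · exact hint.lintegral_lt_top.ne

/-- The noise is subgaussian even conditionally on all contexts, including the future ones. -/
theorem IsBanditProcess.setLIntegral_exp_noise_le [IsProbabilityMeasure μ]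
    (hP : IsBanditProcess μ σ T 𝒳 f η X A Y) (hη : ∀ a, Measurable (η a)) {i : ℕ} (hi : i < T)
    (s : ℝ) {v : ℝ} (hv : (σ : ℝ) ≤ v) {S : Set Ω} (hS : MeasurableSet[revealedSigma X A Y T i] S) :
    ∫⁻ ω in S, ENNReal.ofReal (Real.exp (s * noise η X A Y i ω - s ^ 2 * v ^ 2 / 2)) ∂μ ≤
      μ S := by
  obtain ⟨g, -, hgle, hg⟩ := hP.exists_conditional_bound hη hi s le_rfl
  have hmeas : Measurable fun ω => ENNReal.ofReal (Real.exp (s * noise η X A Y i ω)) :=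
    ENNReal.measurable_ofReal.comp (Real.measurable_exp.comp
      ((measurable_noise hη (hP.pastSigma_le hi)).const_mul s))
  have hsq : (σ : ℝ) ^ 2 ≤ v ^ 2 := pow_le_pow_left₀ σ.2 hv 2
  calc ∫⁻ ω in S, ENNReal.ofReal (Real.exp (s * noise η X A Y i ω - s ^ 2 * v ^ 2 / 2)) ∂μ
      = ∫⁻ ω in S, ENNReal.ofReal (Real.exp (s * noise η X A Y i ω)) *
          ENNReal.ofReal (Real.exp (-(s ^ 2 * v ^ 2 / 2))) ∂μ := by
        refine lintegral_congr fun ω => ?_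
        rw [← ENNReal.ofReal_mul (Real.exp_pos _).le, ← Real.exp_add, sub_eq_add_neg]
    _ = (∫⁻ ω in S, g ω ∂μ) * ENNReal.ofReal (Real.exp (-(s ^ 2 * v ^ 2 / 2))) := by
        rw [lintegral_mul_const _ hmeas, hg S hS]
    _ ≤ (∫⁻ ω in S, ENNReal.ofReal (Real.exp (s ^ 2 * (σ : ℝ) ^ 2 / 2)) ∂μ) *
          ENNReal.ofReal (Real.exp (-(s ^ 2 * v ^ 2 / 2))) := by
        gcongr ?_ * _
        exact lintegral_mono_ae (ae_restrict_of_ae hgle)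
    _ = μ S * ENNReal.ofReal (Real.exp (s ^ 2 * (σ : ℝ) ^ 2 / 2 - s ^ 2 * v ^ 2 / 2)) := by
        rw [setLIntegral_const, mul_comm (ENNReal.ofReal _) (μ S), mul_assoc,
          ← ENNReal.ofReal_mul (Real.exp_pos _).le, ← Real.exp_add, sub_eq_add_neg]
    _ ≤ μ S * 1 := by
        gcongr
        rw [ENNReal.ofReal_le_one, Real.exp_le_one_iff]
        nlinarith [sq_nonneg s]
    _ = μ S := mul_one _

/-- The exponential is a product over all i < t with factor 1 off the ball, to which
`lintegral_prod_le_one` applies along `revealedSigma`. -/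
theorem IsBanditProcess.lintegral_exp_sum_noise_le [IsProbabilityMeasure μ]
    (hP : IsBanditProcess μ σ T 𝒳 f η X A Y) (hη : ∀ a, Measurable (η a)) {t j : ℕ} (ht : t < T)
    (hj : j < T) (a : 𝒜) (s : ℝ) {v : ℝ} (hv : (σ : ℝ) ≤ v) :
    Measurable (fun ω => ENNReal.ofReal (Real.exp (∑ i ∈ ballSamples X A t j a ω,
        (s * noise η X A Y i ω - s ^ 2 * v ^ 2 / 2)))) ∧
      ∫⁻ ω, ENNReal.ofReal (Real.exp (∑ i ∈ ballSamples X A t j a ω,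
        (s * noise η X A Y i ω - s ^ 2 * v ^ 2 / 2))) ∂μ ≤ 1 := by
  classical
  have hmeas : ∀ {m : MeasurableSpace Ω} {i : ℕ}, pastSigma X A Y (i + 1) ≤ m →
      Measurable[m] fun ω =>
        ENNReal.ofReal (Real.exp (s * noise η X A Y i ω - s ^ 2 * v ^ 2 / 2)) := fun hm =>
    ENNReal.measurable_ofReal.comp (Real.measurable_exp.comp
      (((measurable_noise hη hm).const_mul s).sub_const _))
  have hX : ⨆ (l : ℕ) (_ : l < T), MeasurableSpace.comap (X l) inferInstance ≤ mΩ :=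
    iSup₂_le fun l hl => (hP.measurable_context l hl).comap_le
  have h := lintegral_prod_le_one (μ := μ) (revealedSigma X A Y T)
    (fun i k hik => sup_le_sup_right (decisionSigma_mono hik) _) t
    (fun i hi => sup_le (hP.decisionSigma_le (hi.trans ht)) hX)
    (fun i => {ω | i ∈ ballSamples X A t j a ω})
    (fun i hi => measurableSet_mem_ballSamples_revealedSigma ht hj (hi.trans ht) a)
    (fun i ω => ENNReal.ofReal (Real.exp (s * noise η X A Y i ω - s ^ 2 * v ^ 2 / 2)))
    (fun i hi => hmeas (hP.pastSigma_le (hi.trans ht)))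
    (fun i hi => hmeas (le_sup_of_le_left (le_sup_left.trans le_sup_left)))
    (fun i hi S hS => hP.setLIntegral_exp_noise_le hη (hi.trans ht) s hv hS)
  have hprod : (fun ω => ENNReal.ofReal (Real.exp (∑ i ∈ ballSamples X A t j a ω,
      (s * noise η X A Y i ω - s ^ 2 * v ^ 2 / 2)))) =
      fun ω => ∏ i ∈ Finset.range t, (if ω ∈ {ω | i ∈ ballSamples X A t j a ω} then
        ENNReal.ofReal (Real.exp (s * noise η X A Y i ω - s ^ 2 * v ^ 2 / 2)) else 1) := by
    ext ω
    rw [Real.exp_sum, ENNReal.ofReal_prod_of_nonneg fun i _ => (Real.exp_pos _).le]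
    refine (Finset.prod_congr rfl fun i hi => (if_pos hi).symm).trans
      (Finset.prod_subset (fun i hi => ?_) fun i _ hi => if_neg hi)
    exact Finset.mem_range.2 (mem_ballSamples.1 hi).1
  rw [hprod]
  refine ⟨Finset.measurable_fun_prod _ fun i hi => Measurable.ite ?_ ?_ measurable_const, by convert h⟩
  · have hi' := (Finset.mem_range.1 hi).trans ht
    exact measurableSet_mem_ballSamples (hP.measurable_context t ht) (hP.measurable_context j hj)
      (hP.measurable_context i hi') a (hP.measurable_action i hi' a)
  · exact hmeas (hP.pastSigma_le ((Finset.mem_range.1 hi).trans ht))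

/-- Chernoff's bound. A positive v ≥ σ replaces σ because the optimal parameter has v in its
denominator. -/
theorem IsBanditProcess.measure_sum_noise_ge_le [IsProbabilityMeasure μ]
    (hP : IsBanditProcess μ σ T 𝒳 f η X A Y) (hη : ∀ a, Measurable (η a)) {t j k : ℕ} (ht : t < T)
    (hj : j < T) (a : 𝒜) (hk : 1 ≤ k) {ε Λ v : ℝ} (hε : ε ^ 2 = 1) (hΛ : 0 ≤ Λ)
    (hv : (σ : ℝ) ≤ v) (hv0 : 0 < v) :
    μ {ω | (ballSamples X A t j a ω).card = k ∧
        √(2 * v ^ 2 * k * Λ) ≤ ε * ∑ i ∈ ballSamples X A t j a ω, noise η X A Y i ω} ≤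
      ENNReal.ofReal (Real.exp (-Λ)) := by
  have hk0 : (0 : ℝ) < k := by exact_mod_cast hk
  -- The maximizer of s √(2 v² k Λ) - k s² v² / 2, whose maximum is Λ.
  set s : ℝ := √(2 * Λ / (k * v ^ 2)) with hs
  have hs0 : 0 ≤ s := Real.sqrt_nonneg _
  have hs2 : s ^ 2 = 2 * Λ / (k * v ^ 2) := Real.sq_sqrt (by positivity)
  have hsr : s * √(2 * v ^ 2 * k * Λ) = 2 * Λ := by
    rw [hs, ← Real.sqrt_mul (by positivity), show
      2 * Λ / (k * v ^ 2) * (2 * v ^ 2 * k * Λ) = (2 * Λ) ^ 2 by field_simp,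
      Real.sqrt_sq (by positivity)]
  obtain ⟨hmeas, hint⟩ := hP.lintegral_exp_sum_noise_le hη ht hj a (ε * s) hv
  have hsub : {ω | (ballSamples X A t j a ω).card = k ∧
        √(2 * v ^ 2 * k * Λ) ≤ ε * ∑ i ∈ ballSamples X A t j a ω, noise η X A Y i ω} ⊆
      {ω | ENNReal.ofReal (Real.exp Λ) ≤
        ENNReal.ofReal (Real.exp (∑ i ∈ ballSamples X A t j a ω,
          (ε * s * noise η X A Y i ω - (ε * s) ^ 2 * v ^ 2 / 2)))} := by
    rintro ω ⟨hcard, hge⟩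
    refine ENNReal.ofReal_le_ofReal (Real.exp_le_exp.2 ?_)
    rw [Finset.sum_sub_distrib, ← Finset.mul_sum, Finset.sum_const, hcard, nsmul_eq_mul, mul_pow,
      hε, hs2]
    have h1 := mul_le_mul_of_nonneg_left hge hs0
    rw [hsr] at h1
    have h2 : (k : ℝ) * (1 * (2 * Λ / (k * v ^ 2)) * v ^ 2 / 2) = Λ := by field_simp
    rw [h2]
    linarith
  refine (measure_mono hsub).trans ((meas_ge_le_lintegral_div hmeas.aemeasurable
    (ENNReal.ofReal_pos.2 (Real.exp_pos Λ)).ne' ENNReal.ofReal_ne_top).trans ?_)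
  rw [Real.exp_neg, ENNReal.ofReal_inv_of_pos (Real.exp_pos Λ), ← one_div]
  exact ENNReal.div_le_div_right hint _

/-- The deviation bound for the noise over the samples in a ball around the context. -/
theorem IsBanditProcess.measure_sum_noise_gt_le [IsProbabilityMeasure μ]
    (hP : IsBanditProcess μ σ T 𝒳 f η X A Y) (hη : ∀ a, Measurable (η a)) {t j k : ℕ} (ht : t < T)
    (hj : j < T) (a : 𝒜) (hk : 1 ≤ k) {ε Λ : ℝ} (hε : ε ^ 2 = 1) (hΛ : 0 ≤ Λ) :
    μ {ω | (ballSamples X A t j a ω).card = k ∧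
        √(2 * (σ : ℝ) ^ 2 * k * Λ) < ε * ∑ i ∈ ballSamples X A t j a ω, noise η X A Y i ω} ≤
      ENNReal.ofReal (Real.exp (-Λ)) := by
  -- As σ may be 0, it is approached from above; the strict inequality places the event in the
  -- increasing union of the approximating events.
  set v : ℕ → ℝ := fun n => σ + 1 / ((n : ℝ) + 1) with hv
  have hvanti : Antitone v := fun m n hmn =>
    add_le_add_right (one_div_le_one_div_of_le (by positivity) (by gcongr)) _
  have hvσ : ∀ n, (σ : ℝ) ≤ v n := fun n => le_add_of_nonneg_right (by positivity)
  have hv0 : ∀ n, 0 < v n := fun n => add_pos_of_nonneg_of_pos σ.2 (by positivity)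
  have hvlim : Filter.Tendsto v Filter.atTop (nhds σ) := by
    simpa [hv] using tendsto_const_nhds.add (tendsto_one_div_add_atTop_nhds_zero_nat (𝕜 := ℝ))
  set F : ℕ → Set Ω := fun n => {ω | (ballSamples X A t j a ω).card = k ∧
    √(2 * v n ^ 2 * k * Λ) ≤ ε * ∑ i ∈ ballSamples X A t j a ω, noise η X A Y i ω} with hF
  have hFmono : Monotone F := by
    rintro m n hmn ω ⟨h1, h2⟩
    refine ⟨h1, le_trans (Real.sqrt_le_sqrt ?_) h2⟩
    have := pow_le_pow_left₀ (hv0 n).le (hvanti hmn) 2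
    gcongr
  have hlim : Filter.Tendsto (fun n => √(2 * v n ^ 2 * k * Λ)) Filter.atTop
      (nhds √(2 * (σ : ℝ) ^ 2 * k * Λ)) :=
    ((((hvlim.pow 2).const_mul 2).mul_const _).mul_const _).sqrt
  calc _ ≤ μ (⋃ n, F n) := by
        refine measure_mono ?_
        rintro ω ⟨h1, h2⟩
        obtain ⟨n, hn⟩ := (hlim.eventually_lt_const h2).exists
        exact Set.mem_iUnion.2 ⟨n, h1, hn.le⟩
    _ = ⨆ n, μ (F n) := hFmono.measure_iUnion
    _ ≤ _ := iSup_le fun n => hP.measure_sum_noise_ge_le hη ht hj a hk hε hΛ (hvσ n) (hv0 n)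

/-- The noise is under control with probability at least `1 - 2 / T`. -/
theorem IsBanditProcess.measure_not_noiseControlled_le [IsProbabilityMeasure μ] [Nonempty 𝒜]
    (hP : IsBanditProcess μ σ T 𝒳 f η X A Y) (hη : ∀ a, Measurable (η a)) (hd : 1 ≤ d)
    (hT : 2 ≤ T) :
    μ {ω | ¬ NoiseControlled σ T η (fun t => X t ω) (fun t => A t ω) (fun t => Y t ω)} ≤
      ENNReal.ofReal (2 / T) := by
  set Λ := Real.log (d * (T : ℝ) ^ (2 * d + 3) * Fintype.card 𝒜) with hΛ
  set D : Fin T → 𝒜 → Fin T → Fin T → Bool → Set Ω := fun t a j k b =>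
    {ω | (ballSamples X A t j a ω).card = k + 1 ∧ √(2 * (σ : ℝ) ^ 2 * (k + 1 : ℕ) * Λ) <
      (if b then 1 else -1) * ∑ i ∈ ballSamples X A t j a ω, noise η X A Y i ω} with hD
  have hd1 : (1 : ℝ) ≤ d := by exact_mod_cast hd
  have hT2 : (2 : ℝ) ≤ T := by exact_mod_cast hT
  have hA1 : (1 : ℝ) ≤ Fintype.card 𝒜 := by exact_mod_cast (Fintype.card_pos (α := 𝒜))
  have hΛ0 : 0 ≤ Λ := by
    refine Real.log_nonneg ?_
    have : (1 : ℝ) ≤ (T : ℝ) ^ (2 * d + 3) := one_le_pow₀ (by linarith)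
    exact one_le_mul_of_one_le_of_one_le (one_le_mul_of_one_le_of_one_le hd1 this) hA1
  have hDle : ∀ t a j k b, μ (D t a j k b) ≤ ENNReal.ofReal (Real.exp (-Λ)) := fun t a j k b =>
    hP.measure_sum_noise_gt_le hη t.2 j.2 a (by omega) (by cases b <;> norm_num) hΛ0
  have hsub : {ω | ¬ NoiseControlled σ T η (fun t => X t ω) (fun t => A t ω) (fun t => Y t ω)} ⊆
      ⋃ t, ⋃ a, ⋃ j, ⋃ k, ⋃ b, D t a j k b := by
    intro ω hω
    by_contra hnot
    simp only [Set.mem_iUnion, not_exists] at hnot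
    exact hω (noise_controlled_of_forall fun t ht a j hj k hk b =>
      hnot ⟨t, ht⟩ a ⟨j, hj⟩ ⟨k, hk⟩ b)
  have hcount : μ (⋃ t, ⋃ a, ⋃ j, ⋃ k, ⋃ b, D t a j k b) ≤
      ∑ _t : Fin T, ∑ _a : 𝒜, ∑ _j : Fin T, ∑ _k : Fin T, ∑ _b : Bool,
        ENNReal.ofReal (Real.exp (-Λ)) := by
    refine (measure_iUnion_fintype_le _ _).trans (Finset.sum_le_sum fun t _ => ?_)
    refine (measure_iUnion_fintype_le _ _).trans (Finset.sum_le_sum fun a _ => ?_)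
    refine (measure_iUnion_fintype_le _ _).trans (Finset.sum_le_sum fun j _ => ?_)
    refine (measure_iUnion_fintype_le _ _).trans (Finset.sum_le_sum fun k _ => ?_)
    exact (measure_iUnion_fintype_le _ _).trans (Finset.sum_le_sum fun b _ => hDle t a j k b)
  refine (measure_mono hsub).trans (hcount.trans ?_)
  have hT0 : (0 : ℝ) < T := by linarith
  simp only [Finset.sum_const, Finset.card_univ, Fintype.card_fin, Fintype.card_bool,
    ← ENNReal.ofReal_nsmul]
  refine ENNReal.ofReal_le_ofReal ?_
  rw [Real.exp_neg, hΛ, Real.exp_log (by positivity)]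
  simp only [nsmul_eq_mul]
  push_cast
  -- There are 2 T³ |𝒜| events, each of probability at most 1 / (d T^(2d+3) |𝒜|).
  have hpow : (T : ℝ) * T ^ 3 ≤ d * (T : ℝ) ^ (2 * d + 3) := by
    calc (T : ℝ) * T ^ 3 = 1 * T ^ 4 := by ring
      _ ≤ d * (T : ℝ) ^ (2 * d + 3) := by
        gcongr
        · linarith
        · omega
  calc (T : ℝ) * (Fintype.card 𝒜 * (T * (T * (2 *
        (d * (T : ℝ) ^ (2 * d + 3) * Fintype.card 𝒜)⁻¹))))
      = 2 * T ^ 3 / (d * (T : ℝ) ^ (2 * d + 3)) := by field_simp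
    _ ≤ 2 * T ^ 3 / (T * T ^ 3) := by gcongr
    _ = 2 / T := by field_simp

end

end BanditProcess

/-! ## The regret bound -/

section ContextSpace

variable {𝒜 : Type u} {d : ℕ} {𝒳 : Set (EuclideanSpace ℝ (Fin d))}
  {f : EuclideanSpace ℝ (Fin d) → ℝ} {η η' : 𝒜 → EuclideanSpace ℝ (Fin d) → ℝ}
  {Ω : Type v} {T : ℕ} {X : ℕ → Ω → EuclideanSpace ℝ (Fin d)} {A : ℕ → Ω → 𝒜} {Y : ℕ → Ω → ℝ}

theorem cumulativeRegret_le {M : ℝ} {ω : Ω} (hω : ∀ t < T, X t ω ∈ 𝒳)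
    (hgap : ∀ x ∈ 𝒳, ∀ a, gap η a x ≤ M) : cumulativeRegret η T X A ω ≤ T * M := by
  refine (Finset.sum_le_sum fun t ht => hgap _ (hω t (Finset.mem_range.1 ht)) _).trans_eq ?_
  rw [Finset.sum_const, Finset.card_range, nsmul_eq_mul]

variable [MeasurableSpace Ω] {μ : Measure Ω} {σ : ℝ≥0}

theorem IsContextDensity.ae_mem (hf : IsContextDensity 𝒳 f) : ∀ᵐ x ∂contextLaw 𝒳 f, x ∈ 𝒳 :=
  (withDensity_absolutelyContinuous _ _).ae_le (ae_restrict_mem hf.measurableSet)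

theorem IsBanditProcess.ae_context_mem (hP : IsBanditProcess μ σ T 𝒳 f η X A Y)
    (hf : IsContextDensity 𝒳 f) : ∀ᵐ ω ∂μ, ∀ t < T, X t ω ∈ 𝒳 := by
  refine ae_all_iff.2 fun t => ?_
  by_cases ht : t < T
  · have h := hf.ae_mem
    rw [← hP.context_law t ht] at h
    filter_upwards [ae_of_ae_map (hP.measurable_context t ht).aemeasurable h] with ω hω _
    exact hω
  · exact Filter.Eventually.of_forall fun ω h => absurd h ht

theorem gap_congr {a : 𝒜} {x : EuclideanSpace ℝ (Fin d)} (h : ∀ a, η a x = η' a x) :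
    gap η a x = gap η' a x := by
  simp only [gap, bestReward, h]

theorem TsybakovMargin.congr {α Cα : ℝ} (hf : IsContextDensity 𝒳 f)
    (hm : TsybakovMargin α Cα 𝒳 f η) (h : ∀ a, Set.EqOn (η a) (η' a) 𝒳) :
    TsybakovMargin α Cα 𝒳 f η' := by
  intro a w hw
  refine le_of_eq_of_le (measure_congr ?_) (hm a w hw)
  filter_upwards [hf.ae_mem] with x hx
  exact congrArg (fun y => 0 < y ∧ y < w) (gap_congr fun b => (h b hx).symm)

theorem TsybakovMargin.mono {α Cα Cα' : ℝ} (hm : TsybakovMargin α Cα 𝒳 f η) (h : Cα ≤ Cα') :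
    TsybakovMargin α Cα' 𝒳 f η := fun a w hw =>
  (hm a w hw).trans (ENNReal.ofReal_le_ofReal
    (mul_le_mul_of_nonneg_right h (Real.rpow_nonneg hw.le _)))

theorem IsBanditProcess.congr (hP : IsBanditProcess μ σ T 𝒳 f η X A Y)
    (hf : IsContextDensity 𝒳 f) (h : ∀ a, Set.EqOn (η a) (η' a) 𝒳) :
    IsBanditProcess μ σ T 𝒳 f η' X A Y := by
  have hexp : ∀ t < T, ∀ s : ℝ, (fun ω => Real.exp (s * noise η X A Y t ω)) =ᵐ[μ]
      fun ω => Real.exp (s * noise η' X A Y t ω) := fun t ht s => by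
    filter_upwards [hP.ae_context_mem hf] with ω hω
    rw [noise, noise, h _ (hω t ht)]
  exact
    { hP with
      noise_integrable := fun t ht s => (hP.noise_integrable t ht s).congr (hexp t ht s)
      noise_subgaussian := fun t ht s =>
        (condExp_congr_ae (hexp t ht s)).symm.le.trans (hP.noise_subgaussian t ht s) }

theorem cumulativeRegret_congr (hP : IsBanditProcess μ σ T 𝒳 f η X A Y)
    (hf : IsContextDensity 𝒳 f) (h : ∀ a, Set.EqOn (η a) (η' a) 𝒳) :
    cumulativeRegret η' T X A =ᵐ[μ] cumulativeRegret η T X A := by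
  filter_upwards [hP.ae_context_mem hf] with ω hω
  exact Finset.sum_congr rfl fun t ht =>
    gap_congr fun a => (h a (hω t (Finset.mem_range.1 ht))).symm

variable [Fintype 𝒜]

theorem measurable_gap [Nonempty 𝒜] {L : ℝ≥0} (hη : ∀ a, LipschitzWith L (η a)) (a : 𝒜) :
    Measurable (gap η a) := by
  have hlip : LipschitzWith (2 * L) (gap η a) := LipschitzWith.of_dist_le_mul fun x y => by
    rw [Real.dist_eq]
    exact abs_gap_sub_le hη a x y
  exact hlip.continuous.measurable

theorem integrable_cumulativeRegret [Nonempty 𝒜] [IsProbabilityMeasure μ] {L : ℝ≥0} {M : ℝ}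
    (hP : IsBanditProcess μ σ T 𝒳 f η X A Y) (hf : IsContextDensity 𝒳 f)
    (hη : ∀ a, LipschitzWith L (η a)) (hgap : ∀ x ∈ 𝒳, ∀ a, gap η a x ≤ M) :
    Integrable (cumulativeRegret η T X A) μ := by
  refine integrable_finsetSum _ fun t ht => ?_
  have ht' := Finset.mem_range.1 ht
  have hmeas : Measurable fun ω => gap η (A t ω) (X t ω) :=
    measurable_reward_function (η := gap η) (measurable_gap hη)
      (hP.measurable_context t ht').comap_le (hP.comap_action_le ht')
  refine Integrable.of_bound hmeas.aestronglyMeasurable M ?_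
  filter_upwards [hP.ae_context_mem hf] with ω hω
  rw [Real.norm_of_nonneg (gap_nonneg _ _ _)]
  exact hgap _ (hω t ht') _

theorem IsBanditProcess.measure_small_gap_le [Nonempty 𝒜] {L : ℝ≥0} {α Cα : ℝ}
    (hP : IsBanditProcess μ σ T 𝒳 f η X A Y) (hη : ∀ a, LipschitzWith L (η a)) (hCα : 0 ≤ Cα)
    (hm : TsybakovMargin α Cα 𝒳 f η) {t : ℕ} (ht : t < T) (a : 𝒜) {Δ : ℝ} (hΔ : 0 < Δ) :
    MeasurableSet {ω | 0 < gap η a (X t ω) ∧ gap η a (X t ω) < Δ} ∧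
      μ.real {ω | 0 < gap η a (X t ω) ∧ gap η a (X t ω) < Δ} ≤ Cα * Δ ^ α := by
  have hS : MeasurableSet {x | 0 < gap η a x ∧ gap η a x < Δ} :=
    (measurableSet_lt measurable_const (measurable_gap hη a)).inter
      (measurableSet_lt (measurable_gap hη a) measurable_const)
  refine ⟨hP.measurable_context t ht hS, ?_⟩
  have h := hm a Δ hΔ
  rw [← hP.context_law t ht, Measure.map_apply (hP.measurable_context t ht) hS] at h
  exact ENNReal.toReal_le_of_le_ofReal (by positivity) h

end ContextSpace

/-! ### The threshold for the gap and the resulting rate -/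

section Rate

variable {T : ℕ}

/-- Equality holds at e = 1, and T / ln T ≥ 1 makes the right side decrease in e. This lets the
final bound absorb constants. -/
theorem log_le_mul_rate (hT : 2 ≤ T) {e : ℝ} (he : e ≤ 1) :
    Real.log T ≤ T * ((T : ℝ) / Real.log T) ^ (-e) := by
  have hT0 : (0 : ℝ) < T := by positivity
  have hlog : 0 < Real.log T := by linarith [half_lt_log hT]
  have h1 : 1 ≤ (T : ℝ) / Real.log T := by
    rw [one_le_div hlog]
    linarith [Real.log_le_sub_one_of_pos hT0]
  calc Real.log T = T * ((T : ℝ) / Real.log T) ^ (-1 : ℝ) := by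
        rw [Real.rpow_neg_one]
        field_simp
    _ ≤ _ := by
        gcongr

theorem rpow_threshold (hT : 2 ≤ T) (d : ℕ) (β : ℝ) :
    ((Real.log T / T) ^ (1 / ((d : ℝ) + 2))) ^ β = ((T : ℝ) / Real.log T) ^ (-(β / (d + 2))) := by
  have hT0 : (0 : ℝ) < T := by positivity
  have hlog : 0 < Real.log T := by linarith [half_lt_log hT]
  rw [← Real.rpow_mul (by positivity), Real.rpow_neg (by positivity),
    ← Real.inv_rpow (by positivity), inv_div]
  congr 1
  ring

/-- At this threshold Δ the large-gap term ln T · Δ^(α-d-1) equals the small-gap term T Δ^(1+α). -/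
theorem log_mul_rpow_threshold (hT : 2 ≤ T) (d : ℕ) (α : ℝ) :
    Real.log T * ((Real.log T / T) ^ (1 / ((d : ℝ) + 2))) ^ (α - d - 1) =
      T * ((T : ℝ) / Real.log T) ^ (-((1 + α) / (d + 2))) := by
  have hT0 : (0 : ℝ) < T := by positivity
  have hlog : 0 < Real.log T := by linarith [half_lt_log hT]
  rw [rpow_threshold hT, show -((α - d - 1) / ((d : ℝ) + 2)) = -((1 + α) / (d + 2)) + 1 by
    field_simp
    ring, Real.rpow_add (by positivity), Real.rpow_one]
  field_simp

end Rate

/-- The regret bound for reward functions that are Lipschitz on the whole space. -/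
theorem integral_cumulativeRegret_le {d : ℕ} (hd : 1 ≤ d) {α Cα : ℝ} (hα : α ≤ d) (hCα : 0 ≤ Cα)
    {σ L : ℝ≥0} {c κ r₀ M ρ : ℝ} (hc : 0 < c) (hκ : 0 < κ) (hM : 1 ≤ M) (hρ : 0 < ρ)
    (hρr : ρ * M ≤ r₀) (hρL : L * ρ * overlapFactor d σ M ≤ 1 / 2)
    {𝒜 : Type u} [Fintype 𝒜] [Nonempty 𝒜] {𝒳 : Set (EuclideanSpace ℝ (Fin d))}
    {f : EuclideanSpace ℝ (Fin d) → ℝ} {η : 𝒜 → EuclideanSpace ℝ (Fin d) → ℝ}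
    (hf : IsContextDensity 𝒳 f) (hcf : ∀ x ∈ 𝒳, c ≤ f x) (hreg : IsVolumeRegular κ r₀ 𝒳)
    (hmargin : TsybakovMargin α Cα 𝒳 f η) (hη : ∀ a, LipschitzWith L (η a))
    (hgap : ∀ x ∈ 𝒳, ∀ a, gap η a x ≤ M) {T : ℕ} (hT : 2 ≤ T)
    {Ω : Type v} [MeasurableSpace Ω] {μ : Measure Ω} [IsProbabilityMeasure μ]
    {X : ℕ → Ω → EuclideanSpace ℝ (Fin d)} {A : ℕ → Ω → 𝒜} {Y : ℕ → Ω → ℝ}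
    (hP : IsBanditProcess μ σ T 𝒳 f η X A Y)
    (hF : ∀ ω, FollowsAdaptiveUCB σ L T (fun t => X t ω) (fun t => A t ω) (fun t => Y t ω)) :
    ∫ ω, cumulativeRegret η T X A ω ∂μ ≤
      (2 * levelFactor d σ α Cα c κ M ρ + Cα + 4 * M) * ((T : ℝ) * (Fintype.card 𝒜 : ℝ) *
        ((T : ℝ) / Real.log T) ^ (-((1 + α) / ((d : ℝ) + 2)))) := by
  classical
  set R : ℝ := ((T : ℝ) / Real.log T) ^ (-((1 + α) / ((d : ℝ) + 2))) with hR
  set K := levelFactor d σ α Cα c κ M ρ with hK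
  set n : ℝ := (Fintype.card 𝒜 : ℝ) with hn
  have hT0 : (0 : ℝ) < T := by positivity
  have hhalf : 1 / 2 < Real.log T := half_lt_log hT
  have hlog : 0 < Real.log T := by linarith
  have hK0 : 0 ≤ K := levelFactor_nonneg hc hκ hCα hρ
  have hn1 : 1 ≤ n := by
    rw [hn]
    exact_mod_cast (Fintype.card_pos (α := 𝒜))
  have hR0 : 0 < R := by positivity
  have hTR : Real.log T ≤ T * R := by
    refine log_le_mul_rate hT ?_
    rw [div_le_one (by positivity)]
    linarith
  have hint := integrable_cumulativeRegret hP hf hη hgap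
  -- The main argument uses ln |𝒜| ≤ ln T; with more actions than steps the trivial bound T M
  -- suffices.
  rcases le_or_gt (Fintype.card 𝒜) T with hcard | hcard
  · set Δ : ℝ := (Real.log T / T) ^ (1 / ((d : ℝ) + 2)) with hΔdef
    have hΔ : 0 < Δ := by positivity
    set E : ℕ → 𝒜 → Set Ω := fun t a => {ω | 0 < gap η a (X t ω) ∧ gap η a (X t ω) < Δ}
    -- A measurable hull has the same measure and avoids proving the event measurable.
    set B := toMeasurable μ {ω | ¬ NoiseControlled σ T η (fun t => X t ω) (fun t => A t ω)
      (fun t => Y t ω)} with hB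
    have hBmeas : MeasurableSet B := measurableSet_toMeasurable _ _
    have hBle : μ.real B ≤ 2 / T := by
      refine ENNReal.toReal_le_of_le_ofReal (by positivity) ?_
      rw [hB, measure_toMeasurable]
      exact hP.measure_not_noiseControlled_le (fun a => (hη a).continuous.measurable) hd hT
    have hE : ∀ t ∈ Finset.range T, ∀ a, MeasurableSet (E t a) ∧ μ.real (E t a) ≤ Cα * Δ ^ α :=
      fun t ht a => hP.measure_small_gap_le hη hCα hmargin (Finset.mem_range.1 ht) a hΔ
    have hEint : ∀ t ∈ Finset.range T, ∀ a,
        Integrable ((E t a).indicator fun _ => Δ) μ := fun t ht a =>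
      (integrable_const Δ).indicator (hE t ht a).1
    have hsumint : ∀ t ∈ Finset.range T,
        Integrable (fun ω => ∑ a, (E t a).indicator (fun _ => Δ) ω) μ := fun t ht =>
      integrable_finsetSum _ fun a _ => hEint t ht a
    have hBint : Integrable (B.indicator fun _ => (T : ℝ) * M) μ :=
      (integrable_const _).indicator hBmeas
    have hbound : ∀ᵐ ω ∂μ, cumulativeRegret η T X A ω ≤
        n * (2 * K * Real.log T * Δ ^ (α - d - 1)) +
          ∑ t ∈ Finset.range T, ∑ a, (E t a).indicator (fun _ => Δ) ω +
          B.indicator (fun _ => (T : ℝ) * M) ω := by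
      filter_upwards [hP.ae_context_mem hf] with ω hω
      have h1 : (0 : ℝ) ≤ n * (2 * K * Real.log T * Δ ^ (α - d - 1)) := by positivity
      have h2 : (0 : ℝ) ≤ ∑ t ∈ Finset.range T, ∑ a, (E t a).indicator (fun _ => Δ) ω :=
        Finset.sum_nonneg fun t _ => Finset.sum_nonneg fun a _ =>
          Set.indicator_nonneg (fun _ _ => hΔ.le) ω
      by_cases hωB : ω ∈ B
      · rw [Set.indicator_of_mem hωB]
        linarith [cumulativeRegret_le (A := A) hω hgap]
      · rw [Set.indicator_of_notMem hωB, add_zero]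
        have hG : NoiseControlled σ T η (fun t => X t ω) (fun t => A t ω) (fun t => Y t ω) := by
          by_contra hG
          exact hωB (subset_toMeasurable μ _ hG)
        refine (sum_gap_le hd hT hcard hf hα hc hκ hcf hreg hCα hmargin hη hM hgap hρ hρr hρL
          hω hG (hF ω) hΔ).trans_eq ?_
        congr 1
        refine Finset.sum_congr rfl fun t _ => Finset.sum_congr rfl fun a _ => ?_
        rw [Set.indicator_apply]
        congr!
    have hint1 : Integrable (fun ω => n * (2 * K * Real.log T * Δ ^ (α - d - 1)) +
        ∑ t ∈ Finset.range T, ∑ a, (E t a).indicator (fun _ => Δ) ω) μ :=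
      (integrable_const _).add (integrable_finsetSum _ hsumint)
    have hsum : ∫ ω, ∑ t ∈ Finset.range T, ∑ a, (E t a).indicator (fun _ => Δ) ω ∂μ ≤
        T * (n * (Cα * R)) := by
      rw [integral_finsetSum _ hsumint]
      refine (Finset.sum_le_card_nsmul _ _ (n * (Cα * R)) fun t ht => ?_).trans_eq
        (by rw [Finset.card_range, nsmul_eq_mul])
      rw [integral_finsetSum _ fun a _ => hEint t ht a]
      refine (Finset.sum_le_card_nsmul _ _ (Cα * R) fun a _ => ?_).trans_eq
        (by rw [Finset.card_univ, nsmul_eq_mul])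
      rw [integral_indicator_const _ (hE t ht a).1, smul_eq_mul]
      calc μ.real (E t a) * Δ ≤ Cα * Δ ^ α * Δ := by
            gcongr
            exact (hE t ht a).2
        _ = Cα * Δ ^ (1 + α) := by
            rw [Real.rpow_add hΔ, Real.rpow_one]
            ring
        _ = Cα * R := by rw [hΔdef, rpow_threshold hT, hR]
    calc ∫ ω, cumulativeRegret η T X A ω ∂μ
        ≤ ∫ ω, (n * (2 * K * Real.log T * Δ ^ (α - d - 1)) +
          ∑ t ∈ Finset.range T, ∑ a, (E t a).indicator (fun _ => Δ) ω +
          B.indicator (fun _ => (T : ℝ) * M) ω) ∂μ :=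
          integral_mono_ae hint (hint1.add hBint) hbound
      _ = n * (2 * K * (T * R)) +
          ∫ ω, ∑ t ∈ Finset.range T, ∑ a, (E t a).indicator (fun _ => Δ) ω ∂μ +
          μ.real B * (T * M) := by
        rw [integral_add hint1 hBint, integral_add (integrable_const _)
          (integrable_finsetSum _ hsumint), integral_indicator_const _ hBmeas, integral_const,
          probReal_univ, one_smul, smul_eq_mul, mul_assoc (2 * K), hΔdef,
          log_mul_rpow_threshold hT]
      _ ≤ n * (2 * K * (T * R)) + T * (n * (Cα * R)) + 2 / T * (T * M) := by gcongr
      _ = n * (2 * K * (T * R)) + T * (n * (Cα * R)) + 4 * M * (1 / 2) := by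
        field_simp
        ring
      -- The failure cost 2M is absorbed since 1/2 < ln T ≤ T R and n ≥ 1.
      _ ≤ n * (2 * K * (T * R)) + T * (n * (Cα * R)) + 4 * M * (n * (T * R)) := by
        gcongr
        nlinarith
      _ = _ := by ring
  · have hcard' : (T : ℝ) ≤ n := by
      rw [hn]
      exact_mod_cast hcard.le
    have hle : ∫ ω, cumulativeRegret η T X A ω ∂μ ≤ T * M := by
      refine (integral_mono_ae hint (integrable_const ((T : ℝ) * M)) ?_).trans_eq (by simp)
      filter_upwards [hP.ae_context_mem hf] with ω hω
      exact cumulativeRegret_le hω hgap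
    calc ∫ ω, cumulativeRegret η T X A ω ∂μ ≤ T * M := hle
      _ = 2 * M * (T * (1 / 2)) := by ring
      _ ≤ 4 * M * (n * (T * R)) := by
        gcongr
        · norm_num
        · linarith
      _ ≤ (2 * K + Cα + 4 * M) * (n * (T * R)) := by
        gcongr
        linarith
      _ = _ := by ring

theorem theorem5 (d : ℕ) (hd : 1 ≤ d) (α Cα : ℝ) (hα : α ≤ d) (σ L : ℝ≥0)
    (c κ r₀ M : ℝ) (hc : 0 < c) (hκ : 0 < κ) (hr₀ : 0 < r₀) :
    ∃ C : ℝ, 0 < C ∧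
      ∀ (𝒜 : Type u) [Fintype 𝒜] (𝒳 : Set (EuclideanSpace ℝ (Fin d)))
        (f : EuclideanSpace ℝ (Fin d) → ℝ) (η : 𝒜 → EuclideanSpace ℝ (Fin d) → ℝ),
        IsContextDensity 𝒳 f →
        (∀ x ∈ 𝒳, c ≤ f x) →
        IsVolumeRegular κ r₀ 𝒳 →
        TsybakovMargin α Cα 𝒳 f η →
        (∀ a, LipschitzOnWith L (η a) 𝒳) →
        (∀ x ∈ 𝒳, ∀ a, gap η a x ≤ M) →
        ∀ (T : ℕ), 2 ≤ T →
        ∀ (Ω : Type v) [MeasurableSpace Ω] (μ : Measure Ω) [IsProbabilityMeasure μ]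
          (X : ℕ → Ω → EuclideanSpace ℝ (Fin d)) (A : ℕ → Ω → 𝒜) (Y : ℕ → Ω → ℝ),
          IsBanditProcess μ σ T 𝒳 f η X A Y →
          (∀ ω, FollowsAdaptiveUCB σ L T (fun t => X t ω) (fun t => A t ω) (fun t => Y t ω)) →
          Integrable (cumulativeRegret η T X A) μ ∧
          ∫ ω, cumulativeRegret η T X A ω ∂μ ≤
            C * ((T : ℝ) * (Fintype.card 𝒜 : ℝ) *
              ((T : ℝ) / Real.log T) ^ (-((1 + α) / ((d : ℝ) + 2)))) := by
  -- Enlarging M and Cα preserves the hypotheses and provides the signs needed for the constants.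
  set M' := max M 1
  set Cα' := max Cα 0
  have hM1 : 1 ≤ M' := le_max_right _ _
  have hCα' : 0 ≤ Cα' := le_max_right _ _
  have hO := one_le_overlapFactor (d := d) (σ := σ) hM1
  have hO0 : 0 < overlapFactor d σ M' := by linarith
  have hL : (0 : ℝ) ≤ L := L.2
  -- The first bound keeps the balls within the range of volume regularity, the second makes the
  -- radius admissible for the rule for k; L + 1 avoids division by zero.
  set ρ := min (r₀ / M') (1 / (2 * (L + 1) * overlapFactor d σ M')) with hρdef
  have hρ : 0 < ρ := lt_min (by positivity) (by positivity)
  have hρr : ρ * M' ≤ r₀ := (le_div_iff₀ (by positivity)).1 (min_le_left _ _)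
  have hρL : L * ρ * overlapFactor d σ M' ≤ 1 / 2 := by
    have h := (le_div_iff₀ (by positivity)).1
      (min_le_right (r₀ / M') (1 / (2 * (L + 1) * overlapFactor d σ M')))
    rw [← hρdef] at h
    nlinarith [mul_pos hρ hO0]
  have hK := levelFactor_nonneg (d := d) (σ := σ) (α := α) (M := M') hc hκ hCα' hρ
  refine ⟨2 * levelFactor d σ α Cα' c κ M' ρ + Cα' + 4 * M', by positivity, ?_⟩
  intro 𝒜 _ 𝒳 f η hf hcf hreg hmargin hη hgap T hT Ω _ μ _ X A Y hP hF
  obtain ⟨ω₀⟩ : Nonempty Ω := μ.nonempty_of_neZero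
  have : Nonempty 𝒜 := ⟨A 0 ω₀⟩
  -- Extended rewards make the gaps Lipschitz and measurable everywhere, including on balls that
  -- leave 𝒳. Contexts lie in 𝒳 almost surely, so the process, the margin condition and the regret
  -- are unaffected.
  choose η' hη' heq using fun a => (hη a).extend_real
  have hP' := hP.congr hf heq
  have hgap' : ∀ x ∈ 𝒳, ∀ a, gap η' a x ≤ M' := fun x hx a =>
    (gap_congr fun b => heq b hx).symm.trans_le ((hgap x hx a).trans (le_max_left _ _))
  have hae := cumulativeRegret_congr hP hf heq
  refine ⟨(integrable_cumulativeRegret hP' hf hη' hgap').congr hae, ?_⟩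
  rw [← integral_congr_ae hae]
  exact integral_cumulativeRegret_le hd hα hCα' hc hκ hM1 hρ hρr hρL hf hcf hreg
    ((hmargin.mono (le_max_left _ _)).congr hf heq) hη' hgap' hT hP' hF
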